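/- Let $\alpha,\beta>0$ be fixed. **Spaces.** $AP(\mathbb R)$ is the space of Bohr almost periodic functions: continuous $f:\mathbb R\to\mathbb C$ such that for every $\varepsilon>0$ there is $L>0$ such that every interval of length greater than $L$ contains some $\tau$ with $\sup_t|f(t+\tau)-f(t)|\le\varepsilon$. Its norm $\|\cdot\|_{AP}$ comes from the inner product $(f,g)_{AP}=\lim_{T\to+\infty}\frac1{2T}\int_{-T}^{T}f(t)\overline{g(t)}\,dt$, and $AP_2(\mathbb R)$ is the completion of $AP(\mathbb R)$ in this norm. $AP(\mathbb Z)$ is the space of almost periodic sequences: $a:\mathbb Z\to\mathbb C$ such that for every $\varepsilon>0$ there is $N\in\mathbb N$ such that any $N$ consecutive integers include some $p$ with $\sup_{n\in\mathbb Z}|a_{n+p}-a_n|\le\varepsilon$. Its norm comes from the inner product $(a,b)_{AP(\mathbb Z)}=\lim_{p\to+\infty}\frac1{2p}\sum_{n=-p}^{p}a_n\overline{b_n}$. $\ell^2(AP(\mathbb Z))$ is the space of families $a=(a^\ell)_{\ell\in\mathbb Z}$ in $AP(\mathbb Z)$ with $\|a\|^2:=\sum_\ell\|a^\ell\|_{AP(\mathbb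 Z)}^2<\infty$. $W_0$ is the space of continuous functions $\psi\in L^\infty(\mathbb R)$ with $\sum_{k\in\mathbb Z}\operatorname{ess\,sup}_{x\in[0,1]}|\psi(x-k)|<\infty$. Finally $T_x\psi(t)=\psi(t-x)$, $M_\omega\psi(t)=e^{i\omega t}\psi(t)$, and $\langle f,g\rangle=\int_{\mathbb R}f(t)\overline{g(t)}\,dt$. **Theorem.** Let $\psi\in W_0$. Then: 1. For all $b\in AP(\mathbb Z)$ and $\ell\in\mathbb Z$ the series $\sum_{k\in\mathbb Z}b_k\,T_{\alpha k}M_{\beta\ell}\psi(t)$ converges absolutely for every $t\in\mathbb R$, and its sum is a function in $AP(\mathbb R)$. For every $a=(a^\ell)_\ell\in\ell^2(AP(\mathbb Z))$ the series $$T(a):=\sum_{\ell\in\mathbb Z}\Big(\sum_{k\in\mathbb Z}a^\ell_k\,T_{\alpha k}M_{\beta\ell}\psi\Big)$$ converges unconditionally in $AP_2(\mathbb R)$, and $T:\ell^2(AP(\mathbb Z))\to AP_2(\mathbb R)$ is a continuous linear map. 2. There is a constant $C$ such that for every $f\in AP(\mathbb R)$: the integrals $\langle f,T_{\alpha k}M_{\beta\ell}\psi\rangle$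 converge absolutely for all $k,\ell\in\mathbb Z$, the sequence $(\langle f,T_{\alpha k}M_{\beta\ell}\psi\rangle)_{k\in\mathbb Z}$ belongs to $AP(\mathbb Z)$ for every $\ell\in\mathbb Z$, and $$\sum_{\ell\in\mathbb Z}\big\|(\langle f,T_{\alpha k}M_{\beta\ell}\psi\rangle)_{k\in\mathbb Z}\big\|_{AP(\mathbb Z)}^2\le C\,\|f\|_{AP}^2 .$$ -/

import Mathlib

open Filter Topology MeasureTheory
open scoped ENNReal ComplexConjugate

/-- Differences of two relatively dense subsets of the line almost meet in a relatively
dense way. -/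
theorem exists_common_differences {E F : Set ℝ} {L δ : ℝ} (hδ : 0 < δ)
    (hE : ∀ a : ℝ, ∃ τ ∈ E, a ≤ τ ∧ τ ≤ a + L) (hF : ∀ a : ℝ, ∃ σ ∈ F, a ≤ σ ∧ σ ≤ a + L) :
    ∃ K : ℝ, 0 < K ∧ ∀ a : ℝ, ∃ τ₁ ∈ E, ∃ τ₂ ∈ E, ∃ σ₁ ∈ F, ∃ σ₂ ∈ F,
      a ≤ τ₁ - τ₂ ∧ τ₁ - τ₂ ≤ a + K ∧ |(τ₁ - τ₂) - (σ₁ - σ₂)| < δ := by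
  choose τ hτE hτl hτu using hE
  choose σ hσF hσl hσu using hF
  set d : ℝ → ℤ := fun a => ⌊(τ a - σ a) / δ⌋ with hd
  have hfin : (Set.range d).Finite := by
    refine (Set.finite_Icc ⌊-L / δ⌋ ⌊L / δ⌋).subset ?_
    rintro _ ⟨a, rfl⟩
    refine ⟨Int.floor_mono ?_, Int.floor_mono ?_⟩
    · have := hτl a; have := hσu a; gcongr; linarith
    · have := hτu a; have := hσl a; gcongr; linarith
  choose! r hr using (fun (z : ℤ) (hz : z ∈ Set.range d) => hz)
  obtain ⟨K, hK⟩ := (hfin.image (fun z => |τ (r z)|)).bddAbove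
  have hK' : ∀ a, |τ (r (d a))| ≤ K := fun a => hK ⟨d a, ⟨a, rfl⟩, rfl⟩
  have hK0 : 0 ≤ K := (abs_nonneg _).trans (hK' 0)
  have hL0 : 0 ≤ L := by linarith [hτl 0, hτu 0]
  refine ⟨L + 2 * K + 1, by linarith, fun a => ?_⟩
  have hx := hK' (a + K)
  rw [abs_le] at hx
  refine ⟨τ (a + K), hτE _, τ (r (d (a + K))), hτE _, σ (a + K), hσF _, σ (r (d (a + K))), hσF _,
    by linarith [hτl (a + K)], by linarith [hτu (a + K)], ?_⟩
  have h1 : ⌊(τ (r (d (a + K))) - σ (r (d (a + K)))) / δ⌋ = ⌊(τ (a + K) - σ (a + K)) / δ⌋ :=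
    hr (d (a + K)) ⟨a + K, rfl⟩
  have h2 := Int.abs_sub_lt_one_of_floor_eq_floor h1
  rw [← sub_div, abs_div, abs_of_pos hδ, div_lt_one hδ] at h2
  rw [abs_sub_comm] at h2
  rwa [show (τ (a + K) - τ (r (d (a + K)))) - (σ (a + K) - σ (r (d (a + K)))) =
    (τ (a + K) - σ (a + K)) - (τ (r (d (a + K))) - σ (r (d (a + K)))) by ring]

/-! ### Almost periodic functions on the line -/

/-- Bohr almost periodic functions `ℝ → ℂ`. -/
def IsAPFun (f : ℝ → ℂ) : Prop :=
  Continuous f ∧ ∀ ε : ℝ, 0 < ε → ∃ L : ℝ, 0 < L ∧ ∀ a b : ℝ, L < b - a →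
    ∃ τ ∈ Set.Icc a b, ∀ t : ℝ, ‖f (t + τ) - f t‖ ≤ ε

namespace IsAPFun

variable {f g : ℝ → ℂ}

theorem exists_len (hf : IsAPFun f) {ε : ℝ} (hε : 0 < ε) :
    ∃ L : ℝ, 0 < L ∧ ∀ a : ℝ, ∃ τ, (∀ t : ℝ, ‖f (t + τ) - f t‖ ≤ ε) ∧ a ≤ τ ∧ τ ≤ a + L := by
  obtain ⟨L, hL, h⟩ := hf.2 ε hε
  refine ⟨L + 1, by linarith, fun a => ?_⟩
  obtain ⟨τ, hτ, h'⟩ := h a (a + (L + 1)) (by linarith)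
  exact ⟨τ, h', hτ.1, hτ.2⟩

theorem of_exists_len (hc : Continuous f) (h : ∀ ε : ℝ, 0 < ε → ∃ L : ℝ, 0 < L ∧ ∀ a : ℝ,
    ∃ τ, (∀ t : ℝ, ‖f (t + τ) - f t‖ ≤ ε) ∧ a ≤ τ ∧ τ ≤ a + L) : IsAPFun f := by
  refine ⟨hc, fun ε hε => ?_⟩
  obtain ⟨L, hL, h⟩ := h ε hε
  refine ⟨L, hL, fun a b hab => ?_⟩
  obtain ⟨τ, h', h1, h2⟩ := h a
  exact ⟨τ, ⟨h1, by linarith⟩, h'⟩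

theorem bounded (hf : IsAPFun f) : ∃ B : ℝ, 0 < B ∧ ∀ t, ‖f t‖ ≤ B := by
  obtain ⟨L, hL, h⟩ := hf.exists_len one_pos
  obtain ⟨B, hB⟩ := (isCompact_Icc (a := (0 : ℝ)) (b := L)).exists_bound_of_continuousOn
    hf.1.continuousOn
  refine ⟨|B| + 1, by positivity, fun t => ?_⟩
  obtain ⟨τ, h1, h2, h3⟩ := h (-t)
  have h4 := hB (t + τ) ⟨by linarith, by linarith⟩
  have h5 := norm_sub_norm_le (f t) (f (t + τ))
  have h6 := h1 t
  rw [norm_sub_rev] at h6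
  linarith [le_abs_self B]

theorem unif (hf : IsAPFun f) {ε : ℝ} (hε : 0 < ε) :
    ∃ δ : ℝ, 0 < δ ∧ ∀ s t : ℝ, |s - t| < δ → ‖f s - f t‖ ≤ ε := by
  obtain ⟨L, hL, h⟩ := hf.exists_len (show 0 < ε / 3 by positivity)
  have huc := (isCompact_Icc (a := (-1 : ℝ)) (b := L + 1)).uniformContinuousOn_of_continuous
    hf.1.continuousOn
  rw [Metric.uniformContinuousOn_iff] at huc
  obtain ⟨δ, hδ, hu⟩ := huc (ε / 3) (by positivity)
  refine ⟨min δ 1, by positivity, fun s t hst => ?_⟩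
  obtain ⟨h7, h8⟩ := lt_min_iff.1 hst
  obtain ⟨τ, h1, h2, h3⟩ := h (-t)
  have h9 := abs_lt.1 h8
  have h4 := hu (s + τ) ⟨by linarith, by linarith⟩ (t + τ) ⟨by linarith, by linarith⟩
    (by rwa [Real.dist_eq, add_sub_add_right_eq_sub])
  rw [dist_eq_norm] at h4
  have h5 := h1 s
  have h6 := h1 t
  rw [norm_sub_rev] at h5
  calc ‖f s - f t‖ = ‖(f s - f (s + τ)) + (f (s + τ) - f (t + τ)) + (f (t + τ) - f t)‖ := by
        congr 1; ring
    _ ≤ ‖f s - f (s + τ)‖ + ‖f (s + τ) - f (t + τ)‖ + ‖f (t + τ) - f t‖ := norm_add₃_le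
    _ ≤ ε := by linarith

/-- Common almost periods. -/
theorem common (hf : IsAPFun f) (hg : IsAPFun g) {ε : ℝ} (hε : 0 < ε) :
    ∃ L : ℝ, 0 < L ∧ ∀ a : ℝ, ∃ τ, ((∀ t : ℝ, ‖f (t + τ) - f t‖ ≤ ε) ∧
      (∀ t : ℝ, ‖g (t + τ) - g t‖ ≤ ε)) ∧ a ≤ τ ∧ τ ≤ a + L := by
  obtain ⟨L₁, -, h₁⟩ := hf.exists_len (show 0 < ε / 3 by positivity)
  obtain ⟨L₂, -, h₂⟩ := hg.exists_len (show 0 < ε / 3 by positivity)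
  obtain ⟨δ, hδ, hu⟩ := hg.unif (show 0 < ε / 3 by positivity)
  obtain ⟨K, hK, h⟩ := exists_common_differences
    (E := {τ | ∀ t : ℝ, ‖f (t + τ) - f t‖ ≤ ε / 3})
    (F := {τ | ∀ t : ℝ, ‖g (t + τ) - g t‖ ≤ ε / 3}) (L := max L₁ L₂) hδ
    (fun a => by
      obtain ⟨τ, h1, h2, h3⟩ := h₁ a
      exact ⟨τ, h1, h2, by linarith [le_max_left L₁ L₂]⟩)
    (fun a => by
      obtain ⟨τ, h1, h2, h3⟩ := h₂ a
      exact ⟨τ, h1, h2, by linarith [le_max_right L₁ L₂]⟩)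
  refine ⟨K, hK, fun a => ?_⟩
  obtain ⟨τ₁, hτ₁, τ₂, hτ₂, σ₁, hσ₁, σ₂, hσ₂, h1, h2, h3⟩ := h a
  refine ⟨τ₁ - τ₂, ⟨fun t => ?_, fun t => ?_⟩, h1, h2⟩
  · have e1 := hτ₁ (t - τ₂)
    have e2 := hτ₂ (t - τ₂)
    rw [show t - τ₂ + τ₁ = t + (τ₁ - τ₂) by ring] at e1
    rw [show t - τ₂ + τ₂ = t by ring, norm_sub_rev] at e2
    calc ‖f (t + (τ₁ - τ₂)) - f t‖
        = ‖(f (t + (τ₁ - τ₂)) - f (t - τ₂)) + (f (t - τ₂) - f t)‖ := by congr 1; ring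
      _ ≤ _ := norm_add_le _ _
      _ ≤ ε := by linarith
  · have e1 := hσ₁ (t - σ₂)
    have e2 := hσ₂ (t - σ₂)
    have e3 := hu (t + (τ₁ - τ₂)) (t + (σ₁ - σ₂)) (by convert h3 using 2; ring)
    rw [show t - σ₂ + σ₁ = t + (σ₁ - σ₂) by ring] at e1
    rw [show t - σ₂ + σ₂ = t by ring, norm_sub_rev] at e2
    calc ‖g (t + (τ₁ - τ₂)) - g t‖
        = ‖(g (t + (τ₁ - τ₂)) - g (t + (σ₁ - σ₂))) + (g (t + (σ₁ - σ₂)) - g (t - σ₂))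
            + (g (t - σ₂) - g t)‖ := by congr 1; ring
      _ ≤ _ := norm_add₃_le
      _ ≤ ε := by linarith

theorem of_pair (hf : IsAPFun f) (hg : IsAPFun g) {h : ℝ → ℂ} (hc : Continuous h)
    (H : ∀ ε : ℝ, 0 < ε → ∃ δ : ℝ, 0 < δ ∧ ∀ s t : ℝ, ‖f s - f t‖ ≤ δ → ‖g s - g t‖ ≤ δ →
      ‖h s - h t‖ ≤ ε) : IsAPFun h := by
  refine of_exists_len hc fun ε hε => ?_
  obtain ⟨δ, hδ, H⟩ := H ε hε
  obtain ⟨L, hL, hcom⟩ := hf.common hg hδ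
  refine ⟨L, hL, fun a => ?_⟩
  obtain ⟨τ, ⟨h1, h2⟩, h3⟩ := hcom a
  exact ⟨τ, fun t => H _ _ (h1 t) (h2 t), h3⟩

theorem zero : IsAPFun 0 :=
  of_exists_len continuous_const fun ε hε =>
    ⟨1, one_pos, fun a => ⟨a, fun t => by simpa using hε.le, le_rfl, by linarith⟩⟩

theorem add (hf : IsAPFun f) (hg : IsAPFun g) : IsAPFun (f + g) :=
  hf.of_pair hg (hf.1.add hg.1) fun ε hε => ⟨ε / 2, by positivity, fun s t h1 h2 => by
    calc ‖(f + g) s - (f + g) t‖ = ‖(f s - f t) + (g s - g t)‖ := by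
          simp only [Pi.add_apply]; congr 1; ring
      _ ≤ _ := norm_add_le _ _
      _ ≤ ε := by linarith⟩

theorem mul_conj (hf : IsAPFun f) (hg : IsAPFun g) : IsAPFun (fun t => f t * conj (g t)) := by
  obtain ⟨A, hA, hfA⟩ := hf.bounded
  obtain ⟨B, hB, hgB⟩ := hg.bounded
  refine hf.of_pair hg (hf.1.mul (Complex.continuous_conj.comp hg.1)) fun ε hε =>
    ⟨ε / (A + B), by positivity, fun s t h1 h2 => ?_⟩
  calc ‖f s * conj (g s) - f t * conj (g t)‖
      = ‖f s * conj (g s - g t) + (f s - f t) * conj (g t)‖ := by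
        rw [map_sub]; congr 1; ring
    _ ≤ ‖f s‖ * ‖g s - g t‖ + ‖f s - f t‖ * ‖g t‖ := by
        refine (norm_add_le _ _).trans_eq ?_
        simp only [norm_mul, RCLike.norm_conj]
    _ ≤ A * (ε / (A + B)) + (ε / (A + B)) * B := by
        gcongr
        · exact hfA s
        · exact hgB t
    _ = ε := by field_simp

theorem smul (c : ℂ) (hf : IsAPFun f) : IsAPFun (c • f) :=
  hf.of_pair hf (hf.1.const_smul c) fun ε hε => ⟨ε / (‖c‖ + 1), by positivity, fun s t h1 _ => by
    calc ‖(c • f) s - (c • f) t‖ = ‖c‖ * ‖f s - f t‖ := by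
          simp only [Pi.smul_apply, smul_eq_mul, ← mul_sub, norm_mul]
      _ ≤ (‖c‖ + 1) * (ε / (‖c‖ + 1)) := by gcongr; linarith
      _ = ε := by field_simp⟩

theorem shift_estimate (hc : Continuous f) {B L ε : ℝ} (hB : ∀ t, ‖f t‖ ≤ B)
    (h : ∀ a : ℝ, ∃ τ, (∀ t : ℝ, ‖f (t + τ) - f t‖ ≤ ε) ∧ a ≤ τ ∧ τ ≤ a + L) {T : ℝ} (hT : 0 < T)
    (a : ℝ) : ‖(∫ t in (-T)..T, f (t + a)) - ∫ t in (-T)..T, f t‖ ≤ 2 * T * ε + 2 * L * B := by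
  obtain ⟨τ, h1, h2, h3⟩ := h a
  have hi : ∀ x y : ℝ, IntervalIntegrable f volume x y := fun x y => hc.intervalIntegrable x y
  have hB0 : 0 ≤ B := (norm_nonneg _).trans (hB 0)
  have e1 : ‖(∫ t in (-T)..T, f (t + τ)) - ∫ t in (-T)..T, f t‖ ≤ 2 * T * ε := by
    have hc' : Continuous fun t => f (t + τ) := hc.comp (by fun_prop)
    rw [← intervalIntegral.integral_sub (hc'.intervalIntegrable _ _) (hi _ _)]
    refine (intervalIntegral.norm_integral_le_of_norm_le_const (C := ε)
      (fun t _ => h1 t)).trans_eq ?_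
    rw [abs_of_pos (by linarith)]; ring
  have e2 : ‖(∫ t in (-T)..T, f (t + a)) - ∫ t in (-T)..T, f (t + τ)‖ ≤ 2 * L * B := by
    rw [intervalIntegral.integral_comp_add_right, intervalIntegral.integral_comp_add_right,
      intervalIntegral.integral_interval_sub_interval_comm (hi _ _) (hi _ _) (hi _ _)]
    have hn : ∀ c : ℝ, ‖∫ t in (c + a)..(c + τ), f t‖ ≤ L * B := fun c => by
      refine (intervalIntegral.norm_integral_le_of_norm_le_const (C := B)
        (fun t _ => hB t)).trans ?_
      rw [abs_of_nonneg (by linarith), mul_comm]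
      gcongr; linarith
    refine (norm_sub_le _ _).trans ?_
    linarith [hn (-T), hn T]
  calc _ = ‖((∫ t in (-T)..T, f (t + a)) - ∫ t in (-T)..T, f (t + τ))
        + ((∫ t in (-T)..T, f (t + τ)) - ∫ t in (-T)..T, f t)‖ := by congr 1; ring
    _ ≤ _ := norm_add_le _ _
    _ ≤ _ := by linarith

/-- Almost periodic functions have a mean value. -/
theorem exists_mean (hf : IsAPFun f) :
    ∃ m : ℂ, Tendsto (fun T : ℝ => (2 * (T : ℂ))⁻¹ * ∫ t in (-T)..T, f t) atTop (𝓝 m) := by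
  obtain ⟨B, hB, hfB⟩ := hf.bounded
  refine cauchySeq_tendsto_of_complete (Metric.cauchySeq_iff.2 fun ε hε => ?_)
  obtain ⟨L, hL, h⟩ := hf.exists_len (show 0 < ε / 8 by positivity)
  refine ⟨8 * L * B / ε + 1, fun S hS T hT => ?_⟩
  have hLB : 0 ≤ 8 * L * B / ε := by positivity
  have hS0 : 0 < S := by linarith
  have hT0 : 0 < T := by linarith
  have key : ∀ S T : ℝ, 0 < S → 0 < T →
      ‖(∫ s in (-S)..S, ∫ t in (-T)..T, f (t + s)) - 2 * (S : ℂ) * ∫ t in (-T)..T, f t‖ ≤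
        2 * S * (2 * T * (ε / 8) + 2 * L * B) := fun S T hS hT => by
    have hcint : Continuous fun s => ∫ t in (-T)..T, f (t + s) :=
      by
      refine intervalIntegral.continuous_parametric_intervalIntegral_of_continuous'
        (f := fun s t => f (t + s)) ?_ _ _
      exact hf.1.comp (continuous_snd.add continuous_fst)
    have : 2 * (S : ℂ) * (∫ t in (-T)..T, f t) = ∫ s in (-S)..S, ∫ t in (-T)..T, f t := by
      rw [intervalIntegral.integral_const, Complex.real_smul]
      push_cast; ring
    rw [this, ← intervalIntegral.integral_sub (hcint.intervalIntegrable _ _)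
      (continuous_const.intervalIntegrable _ _)]
    refine (intervalIntegral.norm_integral_le_of_norm_le_const
      (fun s _ => shift_estimate hf.1 hfB h hT s)).trans_eq ?_
    rw [abs_of_pos (by linarith)]; ring
  have k1 := key S T hS0 hT0
  have k2 := key T S hT0 hS0
  have hswap : (∫ s in (-S)..S, ∫ t in (-T)..T, f (t + s)) =
      ∫ t in (-T)..T, ∫ s in (-S)..S, f (s + t) := by
    rw [intervalIntegral.integral_of_le (by linarith : -S ≤ S),
      intervalIntegral.integral_of_le (by linarith : -T ≤ T)]
    simp only [intervalIntegral.integral_of_le (by linarith : -S ≤ S),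
      intervalIntegral.integral_of_le (by linarith : -T ≤ T)]
    rw [MeasureTheory.integral_integral_swap]
    · simp only [add_comm]
    · rw [Measure.prod_restrict, Function.uncurry_def]
      refine IntegrableOn.mono_set (t := Set.Icc (-S) S ×ˢ Set.Icc (-T) T) ?_
        (Set.prod_mono Set.Ioc_subset_Icc_self Set.Ioc_subset_Icc_self)
      exact (hf.1.comp (continuous_snd.add continuous_fst)).continuousOn.integrableOn_compact
        (isCompact_Icc.prod isCompact_Icc)
  rw [hswap] at k1
  set P := ∫ t in (-T)..T, ∫ s in (-S)..S, f (s + t)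
  set FS := ∫ t in (-S)..S, f t
  set FT := ∫ t in (-T)..T, f t
  have hSc : (S : ℂ) ≠ 0 := by exact_mod_cast hS0.ne'
  have hTc : (T : ℂ) ≠ 0 := by exact_mod_cast hT0.ne'
  have e : (2 * (S : ℂ))⁻¹ * FS - (2 * (T : ℂ))⁻¹ * FT =
      ((P - 2 * (S : ℂ) * FT) - (P - 2 * (T : ℂ) * FS)) / (4 * S * T) := by
    field_simp; ring
  have hb : ∀ U : ℝ, U ≥ 8 * L * B / ε + 1 → L * B < U * (ε / 8) := fun U hU => by
    have : 8 * L * B / ε < U := by linarith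
    rw [div_lt_iff₀ hε] at this
    linarith
  rw [dist_eq_norm, e, norm_div]
  have hn : ‖(4 * (S : ℂ) * T)‖ = 4 * S * T := by
    simp [abs_of_pos hS0, abs_of_pos hT0]
  rw [hn, div_lt_iff₀ (by positivity)]
  refine (norm_sub_le _ _).trans_lt ?_
  have b1 := hb S hS
  have b2 := hb T hT
  have c1 : T * (L * B) < T * (S * (ε / 8)) := by gcongr
  have c2 : S * (L * B) < S * (T * (ε / 8)) := by gcongr
  have c3 : 0 < S * T * ε := by positivity
  nlinarith

end IsAPFun

/-- The inner product `(f, g)_AP`, as the limit of the averages of `f * conj g`. -/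
noncomputable def apInner (f g : ℝ → ℂ) : ℂ :=
  limUnder atTop fun T : ℝ => (2 * (T : ℂ))⁻¹ * ∫ t in (-T)..T, f t * conj (g t)

theorem IsAPFun.tendsto_apInner {f g : ℝ → ℂ} (hf : IsAPFun f) (hg : IsAPFun g) :
    Tendsto (fun T : ℝ => (2 * (T : ℂ))⁻¹ * ∫ t in (-T)..T, f t * conj (g t)) atTop
      (𝓝 (apInner f g)) :=
  tendsto_nhds_limUnder (hf.mul_conj hg).exists_mean

theorem IsAPFun.tendsto_apInner_self {f : ℝ → ℂ} (hf : IsAPFun f) :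
    Tendsto (fun T : ℝ => (2 * T)⁻¹ * ∫ t in (-T)..T, ‖f t‖ ^ 2) atTop
      (𝓝 (apInner f f).re) := by
  refine ((Complex.continuous_re.tendsto _).comp (hf.tendsto_apInner hf)).congr fun T => ?_
  have : ∀ t, f t * conj (f t) = ((‖f t‖ ^ 2 : ℝ) : ℂ) := fun t => by
    rw [Complex.mul_conj, Complex.normSq_eq_norm_sq]
  simp only [this, intervalIntegral.integral_ofReal, Function.comp]
  rw [← Complex.ofReal_re ((2 * T)⁻¹ * _)]
  congr 1
  push_cast
  rfl

/-- The space `AP(ℝ)`, as a subspace of the space of all functions. -/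
def apSubmodule : Submodule ℂ (ℝ → ℂ) where
  carrier := {f | IsAPFun f}
  add_mem' hf hg := hf.add hg
  zero_mem' := IsAPFun.zero
  smul_mem' c _ hf := hf.smul c

/-- The space `AP(ℝ)`; it carries the norm of the inner product `(f, g)_AP`. -/
def APFun : Type := apSubmodule

namespace APFun

noncomputable instance : AddCommGroup APFun := inferInstanceAs (AddCommGroup apSubmodule)
noncomputable instance : Module ℂ APFun := inferInstanceAs (Module ℂ apSubmodule)
instance : CoeFun APFun (fun _ => ℝ → ℂ) := ⟨fun f => f.1⟩

theorem isAPFun (f : APFun) : IsAPFun f := f.2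

/-- The function space element with a given underlying almost periodic function. -/
def mk (f : ℝ → ℂ) (hf : IsAPFun f) : APFun := ⟨f, hf⟩

theorem eq_zero_of_apInner_self (f : APFun) (h : apInner f f = 0) : f = 0 := by
  have hf := f.isAPFun
  by_contra hne
  obtain ⟨t₀, ht₀⟩ : ∃ t₀, f t₀ ≠ 0 := by
    by_contra hcon
    push Not at hcon
    exact hne (Subtype.ext (funext hcon))
  set η := ‖f t₀‖ with hη
  have hη0 : 0 < η := norm_pos_iff.2 ht₀
  obtain ⟨δ, hδ, hu⟩ := hf.unif (show 0 < η / 4 by positivity)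
  obtain ⟨L, hL, hp⟩ := hf.exists_len (show 0 < η / 4 by positivity)
  have hci : ∀ x y : ℝ, IntervalIntegrable (fun t => ‖f t‖ ^ 2) volume x y :=
    fun x y => (hf.1.norm.pow 2).intervalIntegrable x y
  have hwin : ∀ a : ℝ, δ / 2 * (η / 2) ^ 2 ≤ ∫ t in a..(a + (L + δ)), ‖f t‖ ^ 2 := fun a => by
    obtain ⟨τ, h1, h2, h3⟩ := hp (a - t₀)
    calc δ / 2 * (η / 2) ^ 2 = ∫ t in (t₀ + τ)..(t₀ + τ + δ / 2), (η / 2) ^ 2 := by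
          rw [intervalIntegral.integral_const, smul_eq_mul]; ring
      _ ≤ ∫ t in (t₀ + τ)..(t₀ + τ + δ / 2), ‖f t‖ ^ 2 := by
          refine intervalIntegral.integral_mono_on (by linarith) (by simp) (hci _ _)
            fun t ht => ?_
          have e1 := h1 t₀
          have e2 := hu t (t₀ + τ) (by rw [abs_lt]; constructor <;> linarith [ht.1, ht.2])
          have e3 := norm_sub_norm_le (f t₀) (f (t₀ + τ))
          have e4 := norm_sub_norm_le (f (t₀ + τ)) (f t)
          rw [norm_sub_rev] at e1 e2
          have : η / 2 ≤ ‖f t‖ := by linarith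
          gcongr
      _ ≤ _ := by
          refine intervalIntegral.integral_mono_interval (by linarith) (by linarith) (by linarith)
            (Eventually.of_forall fun t => by positivity) (hci _ _)
  set κ := δ / 2 * (η / 2) ^ 2 with hκ
  have hκ0 : 0 < κ := by positivity
  set W := L + δ with hW
  have hW0 : 0 < W := by positivity
  have hsum : ∀ n : ℕ, 2 * n * κ ≤ ∫ t in (-(n * W))..(n * W), ‖f t‖ ^ 2 := fun n => by
    have := intervalIntegral.sum_integral_adjacent_intervals (μ := volume)
      (f := fun t => ‖f t‖ ^ 2) (a := fun k : ℕ => -(n * W) + k * W) (n := 2 * n)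
      (fun k _ => hci _ _)
    have e : -(n * W) + ((2 * n : ℕ) : ℝ) * W = n * W := by push_cast; ring
    simp only [e, Nat.cast_zero, zero_mul, add_zero] at this
    rw [← this]
    calc 2 * n * κ = ∑ k ∈ Finset.range (2 * n), κ := by simp
      _ ≤ _ := Finset.sum_le_sum fun k _ => by
          have := hwin (-(n * W) + k * W)
          rwa [show -(n * W) + (k : ℝ) * W + W = -(n * W) + ((k + 1 : ℕ) : ℝ) * W by
            push_cast; ring] at this
  have hlim := hf.tendsto_apInner_self
  rw [h, Complex.zero_re] at hlim
  have hlim2 := hlim.comp (tendsto_natCast_atTop_atTop.atTop_mul_const hW0)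
  have : κ / W ≤ 0 := by
    refine ge_of_tendsto hlim2 (eventually_atTop.2 ⟨1, fun n hn => ?_⟩)
    have hn0 : (0 : ℝ) < n := by exact_mod_cast hn
    simp only [Function.comp]
    rw [← div_eq_inv_mul, div_le_div_iff₀ hW0 (by positivity)]
    nlinarith [hsum n]
  have : 0 < κ / W := by positivity
  linarith

@[reducible] noncomputable def innerCore : InnerProductSpace.Core ℂ APFun where
  inner f g := apInner g f
  conj_inner_symm f g := by
    have h := (Complex.continuous_conj.tendsto _).comp (f.isAPFun.tendsto_apInner g.isAPFun)
    refine tendsto_nhds_unique h ((g.isAPFun.tendsto_apInner f.isAPFun).congr fun T => ?_)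
    simp only [Function.comp, map_mul, map_inv₀, map_ofNat, Complex.conj_ofReal]
    rw [intervalIntegral, intervalIntegral, map_sub, ← integral_conj, ← integral_conj]
    simp only [map_mul, Complex.conj_conj]
    simp only [mul_comm]
  re_inner_nonneg f := by
    refine ge_of_tendsto f.isAPFun.tendsto_apInner_self
      (eventually_atTop.2 ⟨0, fun T hT => ?_⟩)
    exact mul_nonneg (by positivity)
      (intervalIntegral.integral_nonneg (by linarith) fun t _ => by positivity)
  add_left f g h := by
    refine tendsto_nhds_unique (h.isAPFun.tendsto_apInner (f + g).isAPFun)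
      (((h.isAPFun.tendsto_apInner f.isAPFun).add
        (h.isAPFun.tendsto_apInner g.isAPFun)).congr fun T => ?_)
    rw [← mul_add, ← intervalIntegral.integral_add
      ((h.isAPFun.mul_conj f.isAPFun).1.intervalIntegrable _ _)
      ((h.isAPFun.mul_conj g.isAPFun).1.intervalIntegrable _ _)]
    congr 2
    funext t
    rw [← mul_add, ← map_add]
    rfl
  smul_left f g c := by
    refine tendsto_nhds_unique (g.isAPFun.tendsto_apInner (c • f).isAPFun)
      (((g.isAPFun.tendsto_apInner f.isAPFun).const_mul (conj c)).congr fun T => ?_)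
    rw [mul_left_comm, ← intervalIntegral.integral_const_mul]
    congr 2
    funext t
    rw [mul_left_comm, ← map_mul]
    rfl
  definite f hf := f.eq_zero_of_apInner_self hf

noncomputable instance : NormedAddCommGroup APFun := innerCore.toNormedAddCommGroup
noncomputable instance : InnerProductSpace ℂ APFun := InnerProductSpace.ofCore innerCore.toCore

theorem norm_sq (f : APFun) : ‖f‖ ^ 2 = (apInner f f).re :=
  norm_sq_eq_re_inner (𝕜 := ℂ) f

end APFun

/-- The Hilbert space `AP₂(ℝ)` of Besicovitch almost periodic functions: the completion of
`AP(ℝ)` for the norm `‖·‖_AP`. -/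
abbrev APTwo : Type := UniformSpace.Completion APFun

/-! ### Almost periodic sequences -/

/-- Almost periodic sequences indexed by `ℤ`. -/
def IsAPSeq (a : ℤ → ℂ) : Prop :=
  ∀ ε : ℝ, 0 < ε → ∃ N : ℕ, ∀ m : ℤ, ∃ p ∈ Set.Ico m (m + N), ∀ n : ℤ, ‖a (n + p) - a n‖ ≤ ε

namespace IsAPSeq

variable {a b : ℤ → ℂ}

theorem bounded (ha : IsAPSeq a) : ∃ B : ℝ, 0 < B ∧ ∀ n, ‖a n‖ ≤ B := by
  obtain ⟨N, h⟩ := ha 1 one_pos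
  obtain ⟨B, hB⟩ := ((Set.finite_Ico (0 : ℤ) N).image (fun n => ‖a n‖)).bddAbove
  refine ⟨|B| + 1, by positivity, fun n => ?_⟩
  obtain ⟨p, ⟨h1, h2⟩, h3⟩ := h (-n)
  have h4 : ‖a (n + p)‖ ≤ B := hB ⟨n + p, ⟨by omega, by omega⟩, rfl⟩
  have h5 := norm_sub_norm_le (a n) (a (n + p))
  have h6 := h3 n
  rw [norm_sub_rev] at h6
  linarith [le_abs_self B]

theorem common (ha : IsAPSeq a) (hb : IsAPSeq b) {ε : ℝ} (hε : 0 < ε) :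
    ∃ N : ℕ, ∀ m : ℤ, ∃ p ∈ Set.Ico m (m + N), (∀ n : ℤ, ‖a (n + p) - a n‖ ≤ ε) ∧
      ∀ n : ℤ, ‖b (n + p) - b n‖ ≤ ε := by
  have aux : ∀ c : ℤ → ℂ, IsAPSeq c → ∃ N : ℕ, ∀ x : ℝ,
      ∃ τ ∈ ((↑) : ℤ → ℝ) '' {p | ∀ n : ℤ, ‖c (n + p) - c n‖ ≤ ε / 2},
        x ≤ τ ∧ τ ≤ x + ((N : ℝ) + 1) := fun c hc => by
    obtain ⟨N, h⟩ := hc (ε / 2) (by positivity)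
    refine ⟨N, fun x => ?_⟩
    obtain ⟨p, ⟨h1, h2⟩, h3⟩ := h ⌈x⌉
    refine ⟨p, ⟨p, h3, rfl⟩, Int.ceil_le.1 h1, ?_⟩
    have : (p : ℝ) < ⌈x⌉ + N := by exact_mod_cast h2
    linarith [Int.ceil_lt_add_one x]
  obtain ⟨N₁, h₁⟩ := aux a ha
  obtain ⟨N₂, h₂⟩ := aux b hb
  obtain ⟨K, hK, h⟩ := exists_common_differences (L := max ((N₁ : ℝ) + 1) ((N₂ : ℝ) + 1)) one_pos
    (fun x => by
      obtain ⟨τ, e1, e2, e3⟩ := h₁ x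
      exact ⟨τ, e1, e2, e3.trans (by gcongr; exact le_max_left _ _)⟩)
    (fun x => by
      obtain ⟨τ, e1, e2, e3⟩ := h₂ x
      exact ⟨τ, e1, e2, e3.trans (by gcongr; exact le_max_right _ _)⟩)
  have half : ∀ (c : ℤ → ℂ) (p q : ℤ), (∀ n : ℤ, ‖c (n + p) - c n‖ ≤ ε / 2) →
      (∀ n : ℤ, ‖c (n + q) - c n‖ ≤ ε / 2) → ∀ n : ℤ, ‖c (n + (p - q)) - c n‖ ≤ ε :=
    fun c p q hp hq n => by
      have e1 := hp (n - q)
      have e2 := hq (n - q)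
      rw [show n - q + p = n + (p - q) by ring] at e1
      rw [show n - q + q = n by ring, norm_sub_rev] at e2
      calc ‖c (n + (p - q)) - c n‖
          = ‖(c (n + (p - q)) - c (n - q)) + (c (n - q) - c n)‖ := by congr 1; ring
        _ ≤ _ := norm_add_le _ _
        _ ≤ ε := by linarith
  refine ⟨⌈K⌉₊ + 1, fun m => ?_⟩
  obtain ⟨_, ⟨p₁, hp₁, rfl⟩, _, ⟨p₂, hp₂, rfl⟩, _, ⟨q₁, hq₁, rfl⟩, _, ⟨q₂, hq₂, rfl⟩, e1, e2, e3⟩ :=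
    h m
  have hpq : p₁ - p₂ = q₁ - q₂ := by
    have : |(p₁ - p₂) - (q₁ - q₂)| < 1 := by exact_mod_cast e3
    rw [Int.abs_lt_one_iff] at this
    omega
  have hKc := Nat.le_ceil K
  refine ⟨p₁ - p₂, ⟨by exact_mod_cast e1, ?_⟩, half a _ _ hp₁ hp₂, ?_⟩
  · have : ((p₁ - p₂ : ℤ) : ℝ) < ((m + (⌈K⌉₊ + 1 : ℕ) : ℤ) : ℝ) := by
      push_cast; linarith
    exact_mod_cast this
  · rw [hpq]; exact half b _ _ hq₁ hq₂

theorem of_pair (ha : IsAPSeq a) (hb : IsAPSeq b) {c : ℤ → ℂ}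
    (H : ∀ ε : ℝ, 0 < ε → ∃ δ : ℝ, 0 < δ ∧ ∀ s t : ℤ, ‖a s - a t‖ ≤ δ → ‖b s - b t‖ ≤ δ →
      ‖c s - c t‖ ≤ ε) : IsAPSeq c := fun ε hε => by
  obtain ⟨δ, hδ, H⟩ := H ε hε
  obtain ⟨N, hcom⟩ := ha.common hb hδ
  refine ⟨N, fun m => ?_⟩
  obtain ⟨p, h3, h1, h2⟩ := hcom m
  exact ⟨p, h3, fun t => H _ _ (h1 t) (h2 t)⟩

theorem zero : IsAPSeq 0 := fun ε hε =>
  ⟨1, fun m => ⟨m, ⟨le_rfl, by simp⟩, fun t => by simpa using hε.le⟩⟩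

theorem add (ha : IsAPSeq a) (hb : IsAPSeq b) : IsAPSeq (a + b) :=
  ha.of_pair hb fun ε hε => ⟨ε / 2, by positivity, fun s t h1 h2 => by
    calc ‖(a + b) s - (a + b) t‖ = ‖(a s - a t) + (b s - b t)‖ := by
          simp only [Pi.add_apply]; congr 1; ring
      _ ≤ _ := norm_add_le _ _
      _ ≤ ε := by linarith⟩

theorem mul_conj (ha : IsAPSeq a) (hb : IsAPSeq b) : IsAPSeq (fun n => a n * conj (b n)) := by
  obtain ⟨A, hA, haA⟩ := ha.bounded
  obtain ⟨B, hB, hbB⟩ := hb.bounded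
  refine ha.of_pair hb fun ε hε => ⟨ε / (A + B), by positivity, fun s t h1 h2 => ?_⟩
  calc ‖a s * conj (b s) - a t * conj (b t)‖
      = ‖a s * conj (b s - b t) + (a s - a t) * conj (b t)‖ := by
        rw [map_sub]; congr 1; ring
    _ ≤ ‖a s‖ * ‖b s - b t‖ + ‖a s - a t‖ * ‖b t‖ := by
        refine (norm_add_le _ _).trans_eq ?_
        simp only [norm_mul, RCLike.norm_conj]
    _ ≤ A * (ε / (A + B)) + (ε / (A + B)) * B := by
        gcongr
        · exact haA s
        · exact hbB t
    _ = ε := by field_simp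

theorem smul (c : ℂ) (ha : IsAPSeq a) : IsAPSeq (c • a) :=
  ha.of_pair ha fun ε hε => ⟨ε / (‖c‖ + 1), by positivity, fun s t h1 _ => by
    calc ‖(c • a) s - (c • a) t‖ = ‖c‖ * ‖a s - a t‖ := by
          simp only [Pi.smul_apply, smul_eq_mul, ← mul_sub, norm_mul]
      _ ≤ (‖c‖ + 1) * (ε / (‖c‖ + 1)) := by gcongr; linarith
      _ = ε := by field_simp⟩

theorem sum_Icc_eq_sum_range {M : Type*} [AddCommMonoid M] (a : ℤ → M) (N : ℕ) :
    ∑ n ∈ Finset.Icc (-(N : ℤ)) N, a n = ∑ i ∈ Finset.range (2 * N + 1), a ((i : ℤ) - N) := by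
  symm
  refine Finset.sum_bij (fun i _ => (i : ℤ) - N) ?_ ?_ ?_ ?_
  · intro i hi
    rw [Finset.mem_range] at hi
    rw [Finset.mem_Icc]
    omega
  · intro i _ j _ h
    omega
  · intro n hn
    rw [Finset.mem_Icc] at hn
    exact ⟨(n + N).toNat, Finset.mem_range.2 (by omega), by omega⟩
  · intro i _
    rfl

theorem shift_estimate {B ε : ℝ} {L : ℕ} (hB : ∀ n, ‖a n‖ ≤ B)
    (h : ∀ m : ℤ, ∃ p ∈ Set.Ico m (m + L), ∀ n : ℤ, ‖a (n + p) - a n‖ ≤ ε) (N : ℕ) (m : ℤ) :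
    ‖(∑ n ∈ Finset.Icc (-(N : ℤ)) N, a (n + m)) - ∑ n ∈ Finset.Icc (-(N : ℤ)) N, a n‖ ≤
      (2 * N + 1) * ε + 2 * L * B := by
  obtain ⟨p, ⟨h1, h2⟩, h3⟩ := h m
  have hB0 : 0 ≤ B := (norm_nonneg _).trans (hB 0)
  have e1 : ‖(∑ n ∈ Finset.Icc (-(N : ℤ)) N, a (n + p)) - ∑ n ∈ Finset.Icc (-(N : ℤ)) N, a n‖ ≤
      (2 * N + 1) * ε := by
    rw [← Finset.sum_sub_distrib]
    refine (norm_sum_le_of_le _ (fun n _ => h3 n)).trans_eq ?_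
    rw [sum_Icc_eq_sum_range (fun _ => ε)]
    simp
  have e2 : ∀ j : ℕ, ‖(∑ n ∈ Finset.Icc (-(N : ℤ)) N, a (n + (m + j))) -
      ∑ n ∈ Finset.Icc (-(N : ℤ)) N, a (n + m)‖ ≤ 2 * j * B := fun j => by
    induction j with
    | zero => simp
    | succ j ih =>
      have e : (∑ n ∈ Finset.Icc (-(N : ℤ)) N, a (n + (m + (j + 1 : ℕ)))) -
          ∑ n ∈ Finset.Icc (-(N : ℤ)) N, a (n + (m + j)) =
          a ((N : ℤ) + 1 + (m + j)) - a (-(N : ℤ) + (m + j)) := by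
        rw [sum_Icc_eq_sum_range (fun n => a (n + (m + (j + 1 : ℕ)))),
          sum_Icc_eq_sum_range (fun n => a (n + (m + j))), ← Finset.sum_sub_distrib]
        have := Finset.sum_range_sub (fun i : ℕ => a ((i : ℤ) - N + (m + j))) (2 * N + 1)
        calc _ = ∑ i ∈ Finset.range (2 * N + 1),
              (a (((i + 1 : ℕ) : ℤ) - N + (m + j)) - a ((i : ℤ) - N + (m + j))) := by
              refine Finset.sum_congr rfl fun i _ => ?_
              congr 2
              push_cast; ring
          _ = _ := by
              rw [this]
              congr 2 <;> push_cast <;> ring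
      calc _ = ‖((∑ n ∈ Finset.Icc (-(N : ℤ)) N, a (n + (m + (j + 1 : ℕ)))) -
            ∑ n ∈ Finset.Icc (-(N : ℤ)) N, a (n + (m + j))) +
            ((∑ n ∈ Finset.Icc (-(N : ℤ)) N, a (n + (m + j))) -
              ∑ n ∈ Finset.Icc (-(N : ℤ)) N, a (n + m))‖ := by congr 1; ring
        _ ≤ (B + B) + 2 * j * B := by
            refine (norm_add_le _ _).trans (add_le_add ?_ ih)
            rw [e]
            exact (norm_sub_le _ _).trans (add_le_add (hB _) (hB _))
        _ = _ := by push_cast; ring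
  have e3 := e2 (p - m).toNat
  rw [show m + ((p - m).toNat : ℤ) = p by omega, norm_sub_rev] at e3
  have e4 : ((p - m).toNat : ℝ) ≤ L := by exact_mod_cast (show (p - m).toNat ≤ L by omega)
  calc _ = ‖((∑ n ∈ Finset.Icc (-(N : ℤ)) N, a (n + m)) -
          ∑ n ∈ Finset.Icc (-(N : ℤ)) N, a (n + p)) +
          ((∑ n ∈ Finset.Icc (-(N : ℤ)) N, a (n + p)) - ∑ n ∈ Finset.Icc (-(N : ℤ)) N, a n)‖ := by
        congr 1; ring
    _ ≤ 2 * (p - m).toNat * B + (2 * N + 1) * ε := (norm_add_le _ _).trans (add_le_add e3 e1)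
    _ ≤ 2 * L * B + (2 * N + 1) * ε := by gcongr
    _ = _ := by ring

/-- Almost periodic sequences have a mean value. -/
theorem exists_mean (ha : IsAPSeq a) :
    ∃ m : ℂ, Tendsto (fun p : ℕ => (2 * (p : ℂ))⁻¹ * ∑ n ∈ Finset.Icc (-(p : ℤ)) p, a n)
      atTop (𝓝 m) := by
  obtain ⟨B, hB, haB⟩ := ha.bounded
  obtain ⟨m, hm⟩ : ∃ m : ℂ, Tendsto
      (fun p : ℕ => (2 * (p : ℂ) + 1)⁻¹ * ∑ n ∈ Finset.Icc (-(p : ℤ)) p, a n) atTop (𝓝 m) := by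
    refine cauchySeq_tendsto_of_complete (Metric.cauchySeq_iff.2 fun ε hε => ?_)
    obtain ⟨L, h⟩ := ha (ε / 8) (by positivity)
    refine ⟨⌈8 * L * B / ε⌉₊ + 1, fun S hS T hT => ?_⟩
    have key : ∀ S T : ℕ,
        ‖(∑ s ∈ Finset.Icc (-(S : ℤ)) S, ∑ t ∈ Finset.Icc (-(T : ℤ)) T, a (t + s)) -
          (2 * (S : ℂ) + 1) * ∑ t ∈ Finset.Icc (-(T : ℤ)) T, a t‖ ≤
          (2 * S + 1) * ((2 * T + 1) * (ε / 8) + 2 * L * B) := fun S T => by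
      have : (2 * (S : ℂ) + 1) * (∑ t ∈ Finset.Icc (-(T : ℤ)) T, a t) =
          ∑ s ∈ Finset.Icc (-(S : ℤ)) S, ∑ t ∈ Finset.Icc (-(T : ℤ)) T, a t := by
        rw [sum_Icc_eq_sum_range (fun _ => ∑ t ∈ Finset.Icc (-(T : ℤ)) T, a t)]
        simp
      rw [this, ← Finset.sum_sub_distrib]
      refine (norm_sum_le_of_le _ (fun s _ => shift_estimate haB h T s)).trans_eq ?_
      rw [sum_Icc_eq_sum_range (fun _ => (2 * (T : ℝ) + 1) * (ε / 8) + 2 * L * B),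
        Finset.sum_const, Finset.card_range, nsmul_eq_mul]
      push_cast; ring
    have k1 := key S T
    have k2 := key T S
    have hswap : (∑ s ∈ Finset.Icc (-(S : ℤ)) S, ∑ t ∈ Finset.Icc (-(T : ℤ)) T, a (t + s)) =
        ∑ t ∈ Finset.Icc (-(T : ℤ)) T, ∑ s ∈ Finset.Icc (-(S : ℤ)) S, a (s + t) := by
      rw [Finset.sum_comm]
      simp only [add_comm]
    rw [hswap] at k1
    set P := ∑ t ∈ Finset.Icc (-(T : ℤ)) T, ∑ s ∈ Finset.Icc (-(S : ℤ)) S, a (s + t)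
    set FS := ∑ t ∈ Finset.Icc (-(S : ℤ)) S, a t
    set FT := ∑ t ∈ Finset.Icc (-(T : ℤ)) T, a t
    set s : ℝ := 2 * S + 1 with hs
    set t : ℝ := 2 * T + 1 with ht
    have hs0 : 0 < s := by positivity
    have ht0 : 0 < t := by positivity
    have hsc : (2 * (S : ℂ) + 1) = (s : ℂ) := by rw [hs]; push_cast; rfl
    have htc : (2 * (T : ℂ) + 1) = (t : ℂ) := by rw [ht]; push_cast; rfl
    rw [hsc] at k1
    rw [htc] at k2
    have hsn : (s : ℂ) ≠ 0 := by exact_mod_cast hs0.ne'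
    have htn : (t : ℂ) ≠ 0 := by exact_mod_cast ht0.ne'
    rw [hsc, htc]
    have e : (s : ℂ)⁻¹ * FS - (t : ℂ)⁻¹ * FT =
        ((P - (s : ℂ) * FT) - (P - (t : ℂ) * FS)) / (s * t) := by
      field_simp; ring
    have hb : ∀ U : ℕ, U ≥ ⌈8 * L * B / ε⌉₊ + 1 → 2 * L * B < (2 * U + 1) * (ε / 8) :=
      fun U hU => by
        have h1 : ((⌈8 * L * B / ε⌉₊ + 1 : ℕ) : ℝ) ≤ U := by exact_mod_cast hU
        push_cast at h1
        have : 8 * L * B / ε < U := by linarith [Nat.le_ceil (8 * L * B / ε)]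
        rw [div_lt_iff₀ hε] at this
        linarith
    rw [dist_eq_norm, e, norm_div]
    have hn : ‖((s : ℂ) * t)‖ = s * t := by
      simp [abs_of_pos hs0, abs_of_pos ht0]
    rw [hn, div_lt_iff₀ (by positivity)]
    refine (norm_sub_le _ _).trans_lt ?_
    have c1 : t * (2 * L * B) < t * (s * (ε / 8)) := mul_lt_mul_of_pos_left (hb S hS) ht0
    have c2 : s * (2 * L * B) < s * (t * (ε / 8)) := mul_lt_mul_of_pos_left (hb T hT) hs0
    have c3 : 0 < s * t * ε := by positivity
    nlinarith
  refine ⟨m, ?_⟩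
  have h1 : Tendsto (fun p : ℕ => 1 + (2⁻¹ : ℂ) * (p : ℂ)⁻¹) atTop (𝓝 (1 + 2⁻¹ * 0)) :=
    (tendsto_inv_atTop_nhds_zero_nat.const_mul _).const_add _
  have h2 := h1.mul hm
  rw [mul_zero, add_zero, one_mul] at h2
  refine h2.congr' (eventually_atTop.2 ⟨1, fun p hp => ?_⟩)
  have hp0 : (p : ℂ) ≠ 0 := by exact_mod_cast (show p ≠ 0 by omega)
  have hp1 : (2 * (p : ℂ) + 1) ≠ 0 := by exact_mod_cast (show 2 * p + 1 ≠ 0 by omega)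
  rw [← mul_assoc]
  congr 1
  field_simp

end IsAPSeq

/-- The inner product `(a, b)_{AP(ℤ)}`, as the limit of the averages of `a * conj b`. -/
noncomputable def apSeqInner (a b : ℤ → ℂ) : ℂ :=
  limUnder atTop fun p : ℕ =>
    (2 * (p : ℂ))⁻¹ * ∑ n ∈ Finset.Icc (-(p : ℤ)) p, a n * conj (b n)

theorem IsAPSeq.tendsto_apSeqInner {a b : ℤ → ℂ} (ha : IsAPSeq a) (hb : IsAPSeq b) :
    Tendsto (fun p : ℕ => (2 * (p : ℂ))⁻¹ * ∑ n ∈ Finset.Icc (-(p : ℤ)) p, a n * conj (b n))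
      atTop (𝓝 (apSeqInner a b)) :=
  tendsto_nhds_limUnder (ha.mul_conj hb).exists_mean

theorem IsAPSeq.tendsto_apSeqInner_self {a : ℤ → ℂ} (ha : IsAPSeq a) :
    Tendsto (fun p : ℕ => (2 * (p : ℝ))⁻¹ * ∑ n ∈ Finset.Icc (-(p : ℤ)) p, ‖a n‖ ^ 2) atTop
      (𝓝 (apSeqInner a a).re) := by
  refine ((Complex.continuous_re.tendsto _).comp (ha.tendsto_apSeqInner ha)).congr fun p => ?_
  have : ∀ n, a n * conj (a n) = ((‖a n‖ ^ 2 : ℝ) : ℂ) := fun n => by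
    rw [Complex.mul_conj, Complex.normSq_eq_norm_sq]
  simp only [this, Function.comp]
  rw [← Complex.ofReal_re ((2 * (p : ℝ))⁻¹ * _)]
  congr 1
  push_cast
  rfl

/-- The space `AP(ℤ)`, as a subspace of the space of all two-sided sequences. -/
def apSeqSubmodule : Submodule ℂ (ℤ → ℂ) where
  carrier := {a | IsAPSeq a}
  add_mem' ha hb := ha.add hb
  zero_mem' := IsAPSeq.zero
  smul_mem' c _ ha := ha.smul c

/-- The space `AP(ℤ)`; it carries the norm of the inner product `(a, b)_{AP(ℤ)}`. -/
def APSeq : Type := apSeqSubmodule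

namespace APSeq

noncomputable instance : AddCommGroup APSeq := inferInstanceAs (AddCommGroup apSeqSubmodule)
noncomputable instance : Module ℂ APSeq := inferInstanceAs (Module ℂ apSeqSubmodule)
instance : CoeFun APSeq (fun _ => ℤ → ℂ) := ⟨fun a => a.1⟩

theorem isAPSeq (a : APSeq) : IsAPSeq a := a.2

theorem eq_zero_of_apSeqInner_self (a : APSeq) (h : apSeqInner a a = 0) : a = 0 := by
  have ha := a.isAPSeq
  by_contra hne
  obtain ⟨n₀, hn₀⟩ : ∃ n₀, a n₀ ≠ 0 := by
    by_contra hcon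
    push Not at hcon
    exact hne (Subtype.ext (funext hcon))
  set η := ‖a n₀‖ with hη
  have hη0 : 0 < η := norm_pos_iff.2 hn₀
  obtain ⟨L, hp⟩ := ha (η / 2) (by positivity)
  have hL : 0 < L := by
    obtain ⟨p, ⟨h1, h2⟩, -⟩ := hp 0
    omega
  have hwin : ∀ m : ℤ, (η / 2) ^ 2 ≤ ∑ i ∈ Finset.range L, ‖a (m + i)‖ ^ 2 := fun m => by
    obtain ⟨p, ⟨h1, h2⟩, h3⟩ := hp (m - n₀)
    have e1 := h3 n₀
    have e3 := norm_sub_norm_le (a n₀) (a (n₀ + p))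
    rw [norm_sub_rev] at e1
    have e4 : η / 2 ≤ ‖a (n₀ + p)‖ := by linarith
    have e5 : m + ((n₀ + p - m).toNat : ℤ) = n₀ + p := by omega
    calc (η / 2) ^ 2 ≤ ‖a (m + ((n₀ + p - m).toNat : ℤ))‖ ^ 2 := by rw [e5]; gcongr
      _ ≤ _ := Finset.single_le_sum (f := fun i : ℕ => ‖a (m + i)‖ ^ 2)
          (fun i _ => by positivity) (Finset.mem_range.2 (by omega))
  have hmul : ∀ (n : ℕ) (m : ℤ),
      n * (η / 2) ^ 2 ≤ ∑ i ∈ Finset.range (n * L), ‖a (m + i)‖ ^ 2 := fun n => by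
    induction n with
    | zero => intro m; simp
    | succ n ih =>
      intro m
      rw [Nat.succ_mul, Finset.sum_range_add]
      have e1 := ih m
      have e2 := hwin (m + (n * L : ℕ))
      have e3 : ∑ i ∈ Finset.range L, ‖a (m + (n * L : ℕ) + i)‖ ^ 2 =
          ∑ i ∈ Finset.range L, ‖a (m + ((n * L + i : ℕ) : ℤ))‖ ^ 2 :=
        Finset.sum_congr rfl fun i _ => by push_cast; rw [add_assoc]
      rw [e3] at e2
      push_cast at e1 e2 ⊢
      linarith
  have hsum : ∀ n : ℕ, 2 * n * (η / 2) ^ 2 ≤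
      ∑ k ∈ Finset.Icc (-((n * L : ℕ) : ℤ)) ((n * L : ℕ) : ℤ), ‖a k‖ ^ 2 := fun n => by
    have e1 := hmul (2 * n) (-((n * L : ℕ) : ℤ))
    rw [IsAPSeq.sum_Icc_eq_sum_range (fun k => ‖a k‖ ^ 2), Finset.sum_range_succ,
      ← mul_assoc 2 n L]
    have e2 : ∑ i ∈ Finset.range (2 * n * L), ‖a (-((n * L : ℕ) : ℤ) + i)‖ ^ 2 =
        ∑ i ∈ Finset.range (2 * n * L), ‖a ((i : ℤ) - ((n * L : ℕ) : ℤ))‖ ^ 2 :=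
      Finset.sum_congr rfl fun i _ => by rw [neg_add_eq_sub]
    rw [e2] at e1
    push_cast at e1 ⊢
    refine e1.trans (le_add_of_nonneg_right (by positivity))
  have hlim := ha.tendsto_apSeqInner_self
  rw [h, Complex.zero_re] at hlim
  have hlim2 := hlim.comp (tendsto_id.atTop_mul_const' hL)
  have hL0 : (0 : ℝ) < L := by exact_mod_cast hL
  have : (η / 2) ^ 2 / L ≤ 0 := by
    refine ge_of_tendsto hlim2 (eventually_atTop.2 ⟨1, fun n hn => ?_⟩)
    have hn0 : (0 : ℝ) < n := by exact_mod_cast hn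
    have e := hsum n
    simp only [Function.comp, id]
    rw [← div_eq_inv_mul, div_le_div_iff₀ hL0 (by push_cast; positivity)]
    push_cast at e ⊢
    nlinarith
  have : 0 < (η / 2) ^ 2 / L := by positivity
  linarith

@[reducible] noncomputable def innerCore : InnerProductSpace.Core ℂ APSeq where
  inner a b := apSeqInner b a
  conj_inner_symm a b := by
    have h := (Complex.continuous_conj.tendsto _).comp (a.isAPSeq.tendsto_apSeqInner b.isAPSeq)
    refine tendsto_nhds_unique h ((b.isAPSeq.tendsto_apSeqInner a.isAPSeq).congr fun T => ?_)
    simp only [Function.comp, map_mul, map_inv₀, map_ofNat, Complex.conj_natCast, map_sum,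
      Complex.conj_conj]
    simp only [mul_comm]
  re_inner_nonneg a := by
    refine ge_of_tendsto a.isAPSeq.tendsto_apSeqInner_self
      (Eventually.of_forall fun p => by positivity)
  add_left a b c := by
    refine tendsto_nhds_unique (c.isAPSeq.tendsto_apSeqInner (a + b).isAPSeq)
      (((c.isAPSeq.tendsto_apSeqInner a.isAPSeq).add
        (c.isAPSeq.tendsto_apSeqInner b.isAPSeq)).congr fun p => ?_)
    rw [← mul_add, ← Finset.sum_add_distrib]
    congr 1
    refine Finset.sum_congr rfl fun n _ => ?_
    rw [← mul_add, ← map_add]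
    rfl
  smul_left a b c := by
    refine tendsto_nhds_unique (b.isAPSeq.tendsto_apSeqInner (c • a).isAPSeq)
      (((b.isAPSeq.tendsto_apSeqInner a.isAPSeq).const_mul (conj c)).congr fun p => ?_)
    rw [mul_left_comm, Finset.mul_sum]
    congr 1
    refine Finset.sum_congr rfl fun n _ => ?_
    rw [mul_left_comm, ← map_mul]
    rfl
  definite a ha := a.eq_zero_of_apSeqInner_self ha

noncomputable instance : NormedAddCommGroup APSeq := innerCore.toNormedAddCommGroup
noncomputable instance : InnerProductSpace ℂ APSeq := InnerProductSpace.ofCore innerCore.toCore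

theorem norm_sq (a : APSeq) : ‖a‖ ^ 2 = (apSeqInner a a).re :=
  norm_sq_eq_re_inner (𝕜 := ℂ) a

end APSeq

/-- The space `ℓ²(AP(ℤ))` of families `(a^ℓ)` in `AP(ℤ)` with `∑ ‖a^ℓ‖² < ∞`. -/
abbrev EllTwoAPSeq : Type := lp (fun _ : ℤ => APSeq) 2

/-! ### Time-frequency shifts and the Wiener space -/

/-- The translation `T_x ψ (t) = ψ (t - x)`. -/
def translation (x : ℝ) (ψ : ℝ → ℂ) : ℝ → ℂ := fun t => ψ (t - x)

/-- The modulation `M_ω ψ (t) = exp (i ω t) ψ (t)`. -/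
noncomputable def modulation (ω : ℝ) (ψ : ℝ → ℂ) : ℝ → ℂ :=
  fun t => Complex.exp (Complex.I * ω * t) * ψ t

/-- The Wiener norm `∑ k, ess sup_{x ∈ [0,1]} |ψ (x - k)|`. -/
noncomputable def wienerNorm (ψ : ℝ → ℂ) : ℝ≥0∞ :=
  ∑' k : ℤ, essSup (fun x => ‖ψ (x - k)‖ₑ) (volume.restrict (Set.Icc (0 : ℝ) 1))

/-- The continuous functions in the Wiener space. -/
def MemWienerCont (ψ : ℝ → ℂ) : Prop :=
  Continuous ψ ∧ MemLp ψ ∞ volume ∧ wienerNorm ψ < ∞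

/-- The `ℓ`-th layer `∑ k, b_k T_{αk} M_{βℓ} ψ` of the synthesis map. -/
noncomputable def synthesisLayer (α β : ℝ) (ψ : ℝ → ℂ) (b : ℤ → ℂ) (ℓ : ℤ) : ℝ → ℂ :=
  fun t => ∑' k : ℤ, b k * translation (α * k) (modulation (β * ℓ) ψ) t

/-- The duality `⟨f, g⟩ = ∫ f(t) conj (g t) dt`. -/
noncomputable def dualPairing (f g : ℝ → ℂ) : ℂ := ∫ t : ℝ, f t * conj (g t)

/-! Everything rests on the bound `norm_sum_layerMap_sq_le` for finite sums of layers. Modulation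
acts before translation, so the phase of `T_{αk} M_{βℓ} ψ (t)` is `exp (iβℓ (t - αk))`. For fixed
`k` the sum over `ℓ` therefore collapses to a trigonometric polynomial `Q_k` of period `2π/β`, and
the sum of the layers is `F t = ∑ k, Q_k (t - αk) ψ (t - αk)`.

Cauchy–Schwarz with weight `|ψ|` gives `|F t|² ≤ V ∑ k, (|Q_k|² |ψ|) (t - αk)`, where `V` sums the
bounds of `ψ` on the cells of `αℤ`. By `tendsto_average_tsum_lattice`, the mean of such a sum of
translates is, up to the density `α⁻¹` of the lattice, the mean over `k` of the integrals `∫ |Q_k|²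
|ψ|`. On each cell of `(2π/β)ℤ` one bounds `ψ` by its maximum and applies Parseval to `Q_k`, so each
integral is at most a constant times `∑ ℓ, |c^ℓ_k|²`; averaging over `k` gives `∑ ℓ, ‖c^ℓ‖²`. A
continuous Wiener function has summable cell bounds for both lattices
(`HasLatticeMajorant.change_lattice`).

The synthesis operator follows by the Cauchy criterion (`exists_synthesis`). Analysis is, up to the
factor `α`, the adjoint of synthesis, by the same averaging principle
(`apSeqInner_integral_mul_conj_translate`); testing with the coefficients themselves turns the
synthesis bound into the analysis bound. -/

/-! ### Lattice majorants -/

/-- The norm of `φ` on the cell `[a j, a (j + 1)]` is at most `v j`, where `v` is summable. -/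
def HasLatticeMajorant {E : Type*} [NormedAddCommGroup E] (a : ℝ) (φ : ℝ → E) (v : ℤ → ℝ) :
    Prop :=
  Summable v ∧ ∀ j : ℤ, ∀ x ∈ Set.Icc (a * j) (a * (j + 1)), ‖φ x‖ ≤ v j

namespace HasLatticeMajorant

variable {E F : Type*} [NormedAddCommGroup E] [NormedAddCommGroup F] {a : ℝ} {φ : ℝ → E}
  {v : ℤ → ℝ}

theorem nonneg (h : HasLatticeMajorant a φ v) (ha : 0 < a) (j : ℤ) : 0 ≤ v j :=
  (norm_nonneg _).trans (h.2 j (a * j) ⟨le_rfl, by nlinarith⟩)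

theorem mono {χ : ℝ → F} (h : HasLatticeMajorant a φ v) (hχ : ∀ x, ‖χ x‖ ≤ ‖φ x‖) :
    HasLatticeMajorant a χ v :=
  ⟨h.1, fun j x hx => (hχ x).trans (h.2 j x hx)⟩

theorem const_mul {χ : ℝ → F} (h : HasLatticeMajorant a φ v) {B : ℝ} (hB : 0 ≤ B)
    (hχ : ∀ x, ‖χ x‖ ≤ B * ‖φ x‖) : HasLatticeMajorant a χ (fun j => B * v j) :=
  ⟨h.1.mul_left B, fun j x hx => (hχ x).trans (mul_le_mul_of_nonneg_left (h.2 j x hx) hB)⟩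

theorem norm_sub_le (h : HasLatticeMajorant a φ v) {m : ℤ} {t : ℝ}
    (ht : t ∈ Set.Icc (a * m) (a * (m + 1))) (k : ℤ) : ‖φ (t - a * k)‖ ≤ v (m - k) := by
  refine h.2 _ _ ⟨?_, ?_⟩ <;> push_cast <;> nlinarith [ht.1, ht.2]

theorem summable_sub (h : HasLatticeMajorant a φ v) (m : ℤ) : Summable fun k => v (m - k) :=
  (Equiv.subLeft m).summable_iff.2 h.1

theorem tsum_sub (v : ℤ → ℝ) (m : ℤ) : ∑' k, v (m - k) = ∑' k, v k :=
  (Equiv.subLeft m).tsum_eq v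

theorem _root_.exists_mem_cell (ha : 0 < a) (t : ℝ) :
    ∃ m : ℤ, a * m ≤ t ∧ t < a * (m + 1) := by
  refine ⟨⌊t / a⌋, ?_, ?_⟩
  · rw [mul_comm, ← le_div_iff₀ ha]; exact Int.floor_le _
  · rw [mul_comm, ← div_lt_iff₀ ha]; exact Int.lt_floor_add_one _

theorem summable_norm (h : HasLatticeMajorant a φ v) (ha : 0 < a) (t : ℝ) :
    Summable fun k : ℤ => ‖φ (t - a * k)‖ := by
  obtain ⟨m, h1, h2⟩ := exists_mem_cell ha t
  exact Summable.of_nonneg_of_le (fun _ => norm_nonneg _) (h.norm_sub_le ⟨h1, h2.le⟩)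
    (h.summable_sub m)

theorem tsum_norm_le (h : HasLatticeMajorant a φ v) (ha : 0 < a) (t : ℝ) :
    ∑' k : ℤ, ‖φ (t - a * k)‖ ≤ ∑' j, v j := by
  obtain ⟨m, h1, h2⟩ := exists_mem_cell ha t
  rw [← tsum_sub v m]
  exact (h.summable_norm ha t).tsum_le_tsum (h.norm_sub_le ⟨h1, h2.le⟩) (h.summable_sub m)

/-- A continuous function with a majorant for one lattice has one for every lattice. -/
theorem change_lattice (h : HasLatticeMajorant a φ v) (hc : Continuous φ) (ha : 0 < a) {b : ℝ}
    (hb : 0 < b) : ∃ w, HasLatticeMajorant b φ w := by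
  have hmax : ∀ i : ℤ, ∃ x ∈ Set.Icc (b * i) (b * (i + 1)), ∀ y ∈ Set.Icc (b * i) (b * (i + 1)),
      ‖φ y‖ ≤ ‖φ x‖ := fun i =>
    isCompact_Icc.exists_isMaxOn (Set.nonempty_Icc.2 (by nlinarith)) hc.norm.continuousOn
  choose x hx hmax using hmax
  choose J hJ1 hJ2 using fun i => exists_mem_cell ha (x i)
  refine ⟨fun i => ‖φ (x i)‖, summable_of_sum_le (c := (⌈a / b⌉₊ + 2 : ℕ) * ∑' j, v j)
    (fun _ => norm_nonneg _) fun s => ?_, hmax⟩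
  calc ∑ i ∈ s, ‖φ (x i)‖ ≤ ∑ i ∈ s, v (J i) :=
        Finset.sum_le_sum fun i _ => h.2 _ _ ⟨hJ1 i, (hJ2 i).le⟩
    _ = ∑ j ∈ s.image J, {i ∈ s | J i = j}.card • v j := Finset.sum_comp v J
    _ ≤ ∑ j ∈ s.image J, (⌈a / b⌉₊ + 2 : ℕ) * v j := by
        refine Finset.sum_le_sum fun j _ => ?_
        rw [nsmul_eq_mul]
        refine mul_le_mul_of_nonneg_right ?_ (h.nonneg ha j)
        -- The maximum point `x i` lies both in the new cell `i` and in the old cell `j`, which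
        -- confines `i` to an interval of length `a / b + 1`. This leaves at most `a / b + 2`
        -- indices, so each `v j` is used at most that often.
        have hsub : {i ∈ s | J i = j} ⊆ Finset.Icc ⌈a / b * j - 1⌉ ⌊a / b * (j + 1)⌋ := by
          intro i hi
          obtain ⟨-, rfl⟩ := Finset.mem_filter.1 hi
          rw [Finset.mem_Icc, Int.ceil_le, Int.le_floor, sub_le_iff_le_add, div_mul_eq_mul_div,
            div_mul_eq_mul_div, div_le_iff₀ hb, le_div_iff₀ hb]
          constructor
          · linarith [hJ1 i, (hx i).2]
          · linarith [hJ2 i, (hx i).1]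
        have hcard := Finset.card_le_card hsub
        rw [Int.card_Icc] at hcard
        have : ⌊a / b * (j + 1)⌋ + 1 - ⌈a / b * j - 1⌉ ≤ (⌈a / b⌉₊ + 2 : ℕ) := by
          have h1 := Int.floor_le (a / b * ((j : ℝ) + 1))
          have h2 := Int.le_ceil (a / b * (j : ℝ) - 1)
          have h3 := Nat.le_ceil (a / b)
          have : ((⌊a / b * ((j : ℝ) + 1)⌋ + 1 - ⌈a / b * (j : ℝ) - 1⌉ : ℤ) : ℝ) ≤
              ((⌈a / b⌉₊ + 2 : ℕ) : ℤ) := by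
            push_cast; linarith
          exact_mod_cast this
        exact_mod_cast hcard.trans (by omega)
    _ = (⌈a / b⌉₊ + 2 : ℕ) * ∑ j ∈ s.image J, v j := (Finset.mul_sum _ _ _).symm
    _ ≤ _ := by
        gcongr
        exact h.1.sum_le_tsum _ fun j _ => h.nonneg ha j

/-- Suprema over unit cells that are summable force integrability; hence the passage to the lattice
of step `1`. -/
theorem integrable [NormedSpace ℝ E] (h : HasLatticeMajorant a φ v) (hc : Continuous φ)
    (ha : 0 < a) : Integrable φ := by
  obtain ⟨w, hw⟩ := h.change_lattice hc ha one_pos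
  refine Real.integrable_of_summable_norm_Icc (f := ⟨φ, hc⟩) ?_
  refine Summable.of_nonneg_of_le (fun _ => norm_nonneg _) (fun n => ?_) hw.1
  rw [ContinuousMap.norm_le _ (hw.nonneg one_pos n)]
  rintro ⟨x, h1, h2⟩
  refine hw.2 n _ ⟨?_, ?_⟩ <;> simp <;> linarith

end HasLatticeMajorant

/-- The maximum of `f` and its essential supremum agrees almost everywhere with that constant. Both
are continuous and the interval is nondegenerate, so they agree everywhere, endpoints included; this
is what closed cells need. -/
theorem le_essSup_of_continuous {f : ℝ → ℝ≥0∞} (hf : Continuous f) {a b x : ℝ} (hab : a < b)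
    (hx : x ∈ Set.Icc a b) : f x ≤ essSup f (volume.restrict (Set.Icc a b)) := by
  refine sup_eq_right.1 (Measure.eqOn_Icc_of_ae_eq volume hab.ne
    (f := fun y => f y ⊔ essSup f (volume.restrict (Set.Icc a b))) (g := fun _ => _) ?_
    (hf.sup continuous_const).continuousOn continuousOn_const hx)
  filter_upwards [ENNReal.ae_le_essSup (μ := volume.restrict (Set.Icc a b)) f] with y hy
  exact sup_eq_right.2 hy

/-- A continuous function in the Wiener space has a lattice majorant. -/
theorem MemWienerCont.exists_hasLatticeMajorant {ψ : ℝ → ℂ} (hψ : MemWienerCont ψ) :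
    ∃ w, HasLatticeMajorant 1 ψ w := by
  obtain ⟨hc, -, hw⟩ := hψ
  unfold wienerNorm at hw
  set e : ℤ → ℝ≥0∞ := fun k =>
    essSup (fun x => ‖ψ (x - k)‖ₑ) (volume.restrict (Set.Icc (0 : ℝ) 1)) with he
  have hs : Summable fun k => (e k).toReal := ENNReal.summable_toReal hw.ne
  have hfin : ∀ k, e k ≠ ∞ := fun k => ENNReal.ne_top_of_tsum_ne_top hw.ne k
  have hle : ∀ (k : ℤ) (x : ℝ), x ∈ Set.Icc (0 : ℝ) 1 → ‖ψ (x - k)‖ ≤ (e k).toReal :=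
    fun k x hx => by
      rw [← toReal_enorm]
      refine ENNReal.toReal_mono (hfin k) ?_
      exact le_essSup_of_continuous (f := fun x : ℝ => ‖ψ (x - k)‖ₑ)
        (hc.comp (continuous_id.sub continuous_const)).enorm zero_lt_one hx
  clear_value e
  -- For `x ∈ [0, 1]` the point `x - k` runs through the cell of index `-k`, hence the sign.
  refine ⟨fun j => (e (-j)).toReal, hs.comp_injective neg_injective, fun j x hx => ?_⟩
  rw [one_mul, one_mul] at hx
  have h := hle (-j) (x - j) ⟨by linarith [hx.1], by linarith [hx.2]⟩
  rwa [Int.cast_neg, sub_neg_eq_add, sub_add_cancel] at h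

/-! ### Sums over translates and their means -/

section LatticeSum

variable {E : Type*} [NormedAddCommGroup E] {a : ℝ} {u : ℤ → ℝ → E} {v : ℤ → ℝ}

theorem summable_norm_lattice (ha : 0 < a) (hu : ∀ k, HasLatticeMajorant a (u k) v) (t : ℝ) :
    Summable fun k : ℤ => ‖u k (t - a * k)‖ := by
  obtain ⟨m, h1, h2⟩ := exists_mem_cell ha t
  exact Summable.of_nonneg_of_le (fun _ => norm_nonneg _)
    (fun k => (hu k).norm_sub_le ⟨h1, h2.le⟩ k) ((hu 0).summable_sub m)

theorem norm_tsum_lattice_le (ha : 0 < a) (hu : ∀ k, HasLatticeMajorant a (u k) v) (t : ℝ) :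
    ‖∑' k : ℤ, u k (t - a * k)‖ ≤ ∑' j, v j := by
  obtain ⟨m, h1, h2⟩ := exists_mem_cell ha t
  rw [← HasLatticeMajorant.tsum_sub v m]
  exact tsum_of_norm_bounded ((hu 0).summable_sub m).hasSum
    fun k => (hu k).norm_sub_le ⟨h1, h2.le⟩ k

/-- The Weierstrass test applies near each point. A point may be the left end of its cell, so its
neighbourhood spans two adjacent cells and the dominating series is the sum of their two shifted
majorants. -/
theorem continuous_tsum_lattice [CompleteSpace E] (ha : 0 < a) (hc : ∀ k, Continuous (u k))
    (hu : ∀ k, HasLatticeMajorant a (u k) v) : Continuous fun t => ∑' k : ℤ, u k (t - a * k) := by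
  refine continuous_iff_continuousAt.2 fun t => ?_
  obtain ⟨m, h1, h2⟩ := exists_mem_cell ha t
  refine ContinuousOn.continuousAt (s := Set.Ioo (a * (m - 1)) (a * (m + 1))) ?_
    (Ioo_mem_nhds (by nlinarith) h2)
  refine continuousOn_tsum (fun k => ((hc k).comp (by fun_prop)).continuousOn)
    (((hu 0).summable_sub (m - 1)).add ((hu 0).summable_sub m)) fun k x hx => ?_
  have hn := (hu 0).nonneg ha
  rcases le_total x (a * m) with h | h
  · refine ((hu k).norm_sub_le (m := m - 1) ⟨?_, ?_⟩ k).trans (le_add_of_nonneg_right (hn _))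
    · push_cast; exact hx.1.le
    · push_cast; simpa using h
  · exact ((hu k).norm_sub_le ⟨h, hx.2.le⟩ k).trans (le_add_of_nonneg_left (hn _))

/-! ### Averages of shifted sequences. -/

variable [NormedSpace ℝ E]

/-- A shift by one step telescopes to two bounded boundary terms, which the factor `(2n)⁻¹` kills. A
general shift is a composition of such steps. -/
theorem tendsto_average_shift {U : ℤ → E} {B : ℝ} (hB : ∀ m, ‖U m‖ ≤ B) (j : ℤ) :
    Tendsto (fun n : ℕ => (2 * (n : ℝ))⁻¹ • ∑ m ∈ Finset.Icc (-(n : ℤ)) n, (U (m - j) - U m))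
      atTop (𝓝 0) := by
  have step : ∀ V : ℤ → E, (∀ m, ‖V m‖ ≤ B) → Tendsto (fun n : ℕ =>
      (2 * (n : ℝ))⁻¹ • ∑ m ∈ Finset.Icc (-(n : ℤ)) n, (V (m - 1) - V m)) atTop (𝓝 0) :=
    fun V hV => by
      have e : ∀ n : ℕ, ∑ m ∈ Finset.Icc (-(n : ℤ)) n, (V (m - 1) - V m) =
          V (-(n : ℤ) - 1) - V n := fun n => by
        rw [IsAPSeq.sum_Icc_eq_sum_range (fun m => V (m - 1) - V m)]
        have := Finset.sum_range_sub' (fun i : ℕ => V ((i : ℤ) - n - 1)) (2 * n + 1)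
        calc _ = ∑ i ∈ Finset.range (2 * n + 1),
              (V ((i : ℤ) - n - 1) - V (((i + 1 : ℕ) : ℤ) - n - 1)) := by
              refine Finset.sum_congr rfl fun i _ => ?_
              congr 2
              push_cast; ring
          _ = _ := by
              rw [this]
              congr 2 <;> push_cast <;> ring
      have h0 : Tendsto (fun n : ℕ => 2⁻¹ * (n : ℝ)⁻¹ * (B + B)) atTop (𝓝 (2⁻¹ * 0 * (B + B))) :=
        (tendsto_inv_atTop_nhds_zero_nat.const_mul _).mul_const _
      rw [mul_zero, zero_mul] at h0
      refine squeeze_zero_norm (fun n => ?_) h0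
      rw [e, norm_smul, mul_inv, Real.norm_of_nonneg (by positivity)]
      gcongr
      exact (norm_sub_le _ _).trans (add_le_add (hV _) (hV _))
  induction j using Int.induction_on with
  | zero => simp
  | succ j ih =>
    have := (step (fun m => U (m - j)) (fun m => hB _)).add ih
    rw [add_zero] at this
    refine this.congr fun n => ?_
    rw [← smul_add, ← Finset.sum_add_distrib]
    congr 1
    refine Finset.sum_congr rfl fun m _ => ?_
    rw [sub_add_sub_cancel, sub_sub, add_comm (1 : ℤ)]
  | pred j ih =>
    have := ih.sub (step (fun m => U (m - (-j - 1))) (fun m => hB _))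
    rw [sub_zero] at this
    refine this.congr fun n => ?_
    rw [← smul_sub, ← Finset.sum_sub_distrib]
    congr 1
    refine Finset.sum_congr rfl fun m _ => ?_
    rw [show m - 1 - (-(j : ℤ) - 1) = m - -j by ring]
    abel

/-- Each `j` contributes the average of a shift difference, which vanishes in the limit, and
dominated convergence allows summing over `j`. The lemma lets the contributions of the cells of
`u_k` be regrouped from the place where they are seen to the index `k` they come from. -/
theorem tendsto_average_tsum_shift [CompleteSpace E] {U : ℤ → ℤ → E} (hv : Summable v)
    (hU : ∀ j m, ‖U j m‖ ≤ v j) :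
    Tendsto (fun n : ℕ => (2 * (n : ℝ))⁻¹ • ((∑ m ∈ Finset.Icc (-(n : ℤ)) n, ∑' j, U j (m - j)) -
      ∑ m ∈ Finset.Icc (-(n : ℤ)) n, ∑' j, U j m)) atTop (𝓝 0) := by
  -- There are `2n + 1` differences of norm at most `2 v j`, and `(2n + 1) / (2n) ≤ 2` for `n ≥ 1`;
  -- this gives `4 v j`. At `n = 0` the inverse is `0` by convention.
  have key := tendsto_tsum_of_dominated_convergence (𝓕 := atTop) (bound := fun j => 4 * v j)
    (f := fun (n : ℕ) j =>
      (2 * (n : ℝ))⁻¹ • ∑ m ∈ Finset.Icc (-(n : ℤ)) n, (U j (m - j) - U j m))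
    (hv.mul_left 4) (fun j => tendsto_average_shift (hU j) j) (Eventually.of_forall fun n j => by
      have h0 : 0 ≤ v j := (norm_nonneg _).trans (hU j 0)
      rw [norm_smul, Real.norm_of_nonneg (by positivity)]
      have h1 : ‖∑ m ∈ Finset.Icc (-(n : ℤ)) n, (U j (m - j) - U j m)‖ ≤
          (2 * n + 1) * (2 * v j) := by
        refine (norm_sum_le_of_le _ (f := fun m => U j (m - j) - U j m) (n := fun _ => 2 * v j)
          (fun m _ => (norm_sub_le _ _).trans ?_)).trans_eq ?_
        · linarith [hU j (m - j), hU j m]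
        · rw [IsAPSeq.sum_Icc_eq_sum_range (fun _ => 2 * v j)]
          simp
      rcases Nat.eq_zero_or_pos n with rfl | hn
      · simpa using h0
      · have hn1 : (1 : ℝ) ≤ n := by exact_mod_cast hn
        rw [inv_mul_le_iff₀ (by positivity)]
        nlinarith)
  rw [tsum_zero] at key
  refine key.congr fun n => ?_
  have hs : ∀ m : ℤ → ℤ, Summable fun j => U j (m j) := fun m =>
    Summable.of_norm_bounded hv fun j => hU j _
  rw [tsum_const_smul'', Summable.tsum_finsetSum, ← Finset.sum_sub_distrib]
  · congr 1
    refine Finset.sum_congr rfl fun m _ => ?_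
    exact (hs fun j => m - j).tsum_sub (hs fun _ => m)
  · exact fun m _ => (hs fun j => m - j).sub (hs fun _ => m)

/-! ### Means of sums of translates. -/

theorem hasSum_integral_cells (ha : 0 < a) {f : ℝ → E} (hf : Integrable f) :
    HasSum (fun j : ℤ => ∫ x in (a * j)..(a * (j + 1)), f x) (∫ x, f x) := by
  have h := ((hf.comp_mul_left' ha.ne').hasSum_intervalIntegral 0).const_smul a
  simp only [zero_add] at h
  rw [Measure.integral_comp_mul_left, abs_of_pos (inv_pos.2 ha), smul_inv_smul₀ ha.ne'] at h
  refine h.congr_fun ?_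
  intro j
  rw [intervalIntegral.integral_comp_mul_left _ ha.ne', smul_inv_smul₀ ha.ne']

/-- The integral of a sum of translates over a cell, as a sum over the cells of the summands. -/
theorem integral_cell_tsum_lattice [CompleteSpace E] (ha : 0 < a) (hc : ∀ k, Continuous (u k))
    (hu : ∀ k, HasLatticeMajorant a (u k) v) (m : ℤ) :
    ∫ t in (a * m)..(a * (m + 1)), ∑' k : ℤ, u k (t - a * k) =
      ∑' j : ℤ, ∫ s in (a * j)..(a * (j + 1)), u (m - j) s := by
  have hle : a * m ≤ a * (m + 1) := by nlinarith
  have h := intervalIntegral.hasSum_integral_of_dominated_convergence (a := a * m)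
    (b := a * (m + 1)) (μ := volume) (F := fun (k : ℤ) t => u k (t - a * k))
    (f := fun t => ∑' k : ℤ, u k (t - a * k)) (fun k _ => v (m - k))
    (fun k => ((hc k).comp (by fun_prop)).aestronglyMeasurable)
    (fun k => Eventually.of_forall fun t ht => by
      rw [Set.uIoc_of_le hle] at ht
      exact (hu k).norm_sub_le ⟨ht.1.le, ht.2⟩ k)
    (Eventually.of_forall fun t _ => (hu 0).summable_sub m)
    intervalIntegrable_const
    (Eventually.of_forall fun t _ => (summable_norm_lattice ha hu t).of_norm.hasSum)
  -- The substitution `s = t - a k` carries cell `m` to cell `m - k`; the new summation index is `j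
  -- = m - k`.
  rw [← h.tsum_eq, ← (Equiv.subLeft m).tsum_eq]
  refine tsum_congr fun j => ?_
  rw [intervalIntegral.integral_comp_sub_right (fun s => u (Equiv.subLeft m j) s)]
  simp only [Equiv.subLeft_apply]
  congr 1 <;> push_cast <;> ring

/-- The means of a sum of translates `∑ k, u_k (t - a k)` and of the sequence `∫ u_k` agree. -/
theorem tendsto_average_tsum_lattice [CompleteSpace E] (ha : 0 < a) (hc : ∀ k, Continuous (u k))
    (hu : ∀ k, HasLatticeMajorant a (u k) v) :
    Tendsto (fun n : ℕ => (2 * (n : ℝ))⁻¹ • ((∫ t in (-(a * n))..(a * n),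
      ∑' k : ℤ, u k (t - a * k)) - ∑ k ∈ Finset.Icc (-(n : ℤ)) n, ∫ s, u k s)) atTop (𝓝 0) := by
  set H : ℝ → E := fun t => ∑' k : ℤ, u k (t - a * k) with hH
  have hHc : Continuous H := continuous_tsum_lattice ha hc hu
  have hi : ∀ x y, IntervalIntegrable H volume x y := fun x y => hHc.intervalIntegrable x y
  -- With `U j m` the integral of `u m` over cell `j`, the sum of `U j (m - j)` over `j` is the
  -- integral of `H` over cell `m`, while the sum of `U j m` is the full integral of `u m`.
  have h1 := tendsto_average_tsum_shift (v := fun j => v j * a) (hu 0 |>.1.mul_right a)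
    (U := fun j m => ∫ s in (a * j)..(a * (j + 1)), u m s) (fun j m => by
      have hle : a * j ≤ a * (j + 1) := by nlinarith
      refine (intervalIntegral.norm_integral_le_of_norm_le_const (C := v j) fun x hx => ?_).trans_eq
        ?_
      · rw [Set.uIoc_of_le hle] at hx
        exact (hu m).2 j x ⟨hx.1.le, hx.2⟩
      · rw [show a * ((j : ℝ) + 1) - a * j = a by ring, abs_of_pos ha])
  -- The cells of index `-n, …, n` fill `[-a n, a (n + 1)]`, one cell more than the window. The
  -- extra cell has a bounded integral and is negligible on average.
  have h2 : Tendsto (fun n : ℕ => (2 * (n : ℝ))⁻¹ • ∫ t in (a * n)..(a * (n + 1)), H t) atTop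
      (𝓝 0) := by
    have h0 : Tendsto (fun n : ℕ => 2⁻¹ * (n : ℝ)⁻¹ * ((∑' j, v j) * a)) atTop
        (𝓝 (2⁻¹ * 0 * ((∑' j, v j) * a))) :=
      (tendsto_inv_atTop_nhds_zero_nat.const_mul _).mul_const _
    rw [mul_zero, zero_mul] at h0
    refine squeeze_zero_norm (fun n => ?_) h0
    rw [norm_smul, mul_inv, Real.norm_of_nonneg (by positivity)]
    gcongr
    refine (intervalIntegral.norm_integral_le_of_norm_le_const (C := ∑' j, v j)
      fun t _ => norm_tsum_lattice_le ha hu t).trans_eq ?_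
    rw [show a * ((n : ℝ) + 1) - a * n = a by ring, abs_of_pos ha]
  have h3 := h1.sub h2
  rw [sub_zero] at h3
  refine h3.congr fun n => ?_
  rw [← smul_sub]
  congr 1
  have e1 : ∑ m ∈ Finset.Icc (-(n : ℤ)) n, ∑' j : ℤ, ∫ s in (a * j)..(a * (j + 1)), u (m - j) s =
      (∫ t in (-(a * n))..(a * n), H t) + ∫ t in (a * n)..(a * (n + 1)), H t := by
    rw [intervalIntegral.integral_add_adjacent_intervals (hi _ _) (hi _ _)]
    simp only [← integral_cell_tsum_lattice ha hc hu]
    rw [IsAPSeq.sum_Icc_eq_sum_range (fun m : ℤ => ∫ t in (a * m)..(a * (m + 1)), H t)]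
    have := intervalIntegral.sum_integral_adjacent_intervals (μ := volume) (f := H)
      (a := fun k : ℕ => a * ((k : ℝ) - n)) (n := 2 * n + 1) (fun k _ => hi _ _)
    simp only [Nat.cast_zero, zero_sub, mul_neg] at this
    rw [show ((2 * n + 1 : ℕ) : ℝ) - n = n + 1 by push_cast; ring] at this
    rw [← this]
    refine Finset.sum_congr rfl fun k _ => ?_
    rw [show (((k : ℤ) - n : ℤ) : ℝ) = k - n by push_cast; rfl,
      show (k : ℝ) - n + 1 = ((k + 1 : ℕ) : ℝ) - n by push_cast; ring]
  have e2 : ∀ m : ℤ, ∑' j : ℤ, ∫ s in (a * j)..(a * (j + 1)), u m s = ∫ s, u m s := fun m =>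
    (hasSum_integral_cells ha ((hu m).integrable (hc m) ha)).tsum_eq
  simp only [e1, e2]
  abel

end LatticeSum


/-! ### Almost periodicity of layers and of pairings -/

/-- Almost periodic functions have almost periods close to a given lattice of the line. -/
theorem IsAPFun.exists_lattice_almost_periods {f : ℝ → ℂ} (hf : IsAPFun f) {a : ℝ} (ha : 0 < a)
    {ε : ℝ} (hε : 0 < ε) : ∃ N : ℕ, ∀ m : ℤ, ∃ p ∈ Set.Ico m (m + N),
      ∀ t, ‖f (t + a * p) - f t‖ ≤ ε := by
  obtain ⟨L, hL, hper⟩ := hf.exists_len (show 0 < ε / 3 by positivity)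
  obtain ⟨δ, hδ, hu⟩ := hf.unif (show 0 < ε / 3 by positivity)
  obtain ⟨K, hK, h⟩ := exists_common_differences
    (E := {τ | ∀ t : ℝ, ‖f (t + τ) - f t‖ ≤ ε / 3}) (F := Set.range fun n : ℤ => a * (n : ℝ))
    (L := max L a) hδ
    (fun x => by
      obtain ⟨τ, h1, h2, h3⟩ := hper x
      exact ⟨τ, h1, h2, by linarith [le_max_left L a]⟩)
    (fun x => by
      obtain ⟨m, h1, h2⟩ := exists_mem_cell ha x
      refine ⟨a * ((m + 1 : ℤ) : ℝ), ⟨m + 1, rfl⟩, ?_, ?_⟩ <;> push_cast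
      · exact h2.le
      · linarith [le_max_right L a])
  -- Differences of almost periods are sought from `a * m + δ` on, so that the lattice point within
  -- `δ` of one stays beyond `a * m`. That point also lies before `a * m + K + 2 * δ`. Uniform
  -- continuity of `f` pays for the displacement.
  refine ⟨⌈(K + 2 * δ) / a⌉₊ + 2, fun m => ?_⟩
  obtain ⟨τ₁, hτ₁, τ₂, hτ₂, _, ⟨p₁, rfl⟩, _, ⟨p₂, rfl⟩, h1, h2, h3⟩ := h (a * m + δ)
  have h4 := abs_lt.1 h3
  refine ⟨p₁ - p₂, ⟨?_, ?_⟩, fun t => ?_⟩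
  · have : a * (m : ℝ) < a * ((p₁ - p₂ : ℤ) : ℝ) := by push_cast; linarith [h4.2]
    exact_mod_cast (lt_of_mul_lt_mul_left this ha.le).le
  · have : ((p₁ - p₂ : ℤ) : ℝ) - m ≤ (K + 2 * δ) / a := by
      rw [le_div_iff₀ ha]; push_cast; linarith [h4.1]
    have h6 := this.trans (Nat.le_ceil _)
    have : ((p₁ - p₂ : ℤ) : ℝ) < ((m + (⌈(K + 2 * δ) / a⌉₊ + 2 : ℕ) : ℤ) : ℝ) := by
      push_cast at h6 ⊢; linarith
    exact_mod_cast this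
  · have e1 := hτ₁ (t - τ₂)
    have e2 := hτ₂ (t - τ₂)
    have e3 := hu (t + a * ((p₁ - p₂ : ℤ) : ℝ)) (t + (τ₁ - τ₂)) (by
      rw [abs_sub_comm]
      convert h3 using 2
      push_cast; ring)
    rw [show t - τ₂ + τ₁ = t + (τ₁ - τ₂) by ring] at e1
    rw [show t - τ₂ + τ₂ = t by ring, norm_sub_rev] at e2
    calc ‖f (t + a * ((p₁ - p₂ : ℤ) : ℝ)) - f t‖
        = ‖(f (t + a * ((p₁ - p₂ : ℤ) : ℝ)) - f (t + (τ₁ - τ₂))) + (f (t + (τ₁ - τ₂)) - f (t - τ₂))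
          + (f (t - τ₂) - f t)‖ := by congr 1; ring
      _ ≤ _ := norm_add₃_le
      _ ≤ ε := by linarith

section Layer

variable {a : ℝ} {g : ℝ → ℂ} {v : ℤ → ℝ}

theorem summable_mul_translate (ha : 0 < a) (h : HasLatticeMajorant a g v) {b : ℤ → ℂ}
    (hb : IsAPSeq b) (t : ℝ) : Summable fun k : ℤ => b k * g (t - a * k) := by
  obtain ⟨B, -, hB⟩ := hb.bounded
  refine Summable.of_norm_bounded ((h.summable_norm ha t).mul_left B) fun k => ?_
  rw [norm_mul]
  exact mul_le_mul_of_nonneg_right (hB k) (norm_nonneg _)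

/-- Translating the sum by `a p` shifts the coefficients by `p`. An almost period `p` of `b` thus
gives the almost period `a p` of the sum, with the error multiplied by at most `∑ j, v j`. -/
theorem isAPFun_tsum_mul_translate (ha : 0 < a) (hc : Continuous g)
    (h : HasLatticeMajorant a g v) {b : ℤ → ℂ} (hb : IsAPSeq b) :
    IsAPFun fun t => ∑' k : ℤ, b k * g (t - a * k) := by
  obtain ⟨B, hB0, hB⟩ := hb.bounded
  have hcont := continuous_tsum_lattice (u := fun k s => b k * g s) ha
    (fun k => continuous_const.mul hc) (fun k => h.const_mul hB0.le fun x => by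
      rw [norm_mul]; exact mul_le_mul_of_nonneg_right (hB k) (norm_nonneg _))
  refine IsAPFun.of_exists_len hcont fun ε hε => ?_
  set V := ∑' j, v j with hV
  have hV0 : 0 ≤ V := tsum_nonneg fun j => h.nonneg ha j
  obtain ⟨N, hN⟩ := hb (ε / (V + 1)) (by positivity)
  -- For `x` in cell `m`, almost periods of `b` are taken from `m + 1` on, since `a * m` may lie to
  -- the left of `x`.
  refine ⟨a * (N + 1), by positivity, fun x => ?_⟩
  obtain ⟨m, h1, h2⟩ := exists_mem_cell ha x
  obtain ⟨p, ⟨hp1, hp2⟩, hp⟩ := hN (m + 1)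
  have hp1' : ((m + 1 : ℤ) : ℝ) ≤ p := by exact_mod_cast hp1
  have hp2' : (p : ℝ) ≤ ((m + N : ℤ) : ℝ) := by exact_mod_cast (by omega : p ≤ m + N)
  push_cast at hp1' hp2'
  refine ⟨a * p, fun t => ?_, ?_, ?_⟩
  · have e : ∑' k : ℤ, b k * g (t + a * p - a * k) = ∑' k : ℤ, b (k + p) * g (t - a * k) := by
      rw [← (Equiv.addRight p).tsum_eq]
      refine tsum_congr fun k => ?_
      simp only [Equiv.coe_addRight]
      congr 2
      push_cast; ring
    have hs := h.summable_norm ha t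
    have hs1 := summable_mul_translate ha h hb t
    have hs2 : Summable fun k : ℤ => b (k + p) * g (t - a * k) := by
      refine Summable.of_norm_bounded (hs.mul_left B) fun k => ?_
      rw [norm_mul]
      exact mul_le_mul_of_nonneg_right (hB _) (norm_nonneg _)
    rw [e, ← hs2.tsum_sub hs1]
    calc ‖∑' k : ℤ, (b (k + p) * g (t - a * k) - b k * g (t - a * k))‖
        ≤ ε / (V + 1) * ∑' k : ℤ, ‖g (t - a * k)‖ := by
          refine tsum_of_norm_bounded (hs.hasSum.mul_left _) fun k => ?_
          rw [← sub_mul, norm_mul]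
          exact mul_le_mul_of_nonneg_right (hp k) (norm_nonneg _)
      _ ≤ ε / (V + 1) * (V + 1) := by
          gcongr
          linarith [h.tsum_norm_le ha t]
      _ = ε := by field_simp
  · nlinarith
  · nlinarith

theorem integrable_mul_conj_translate {f : ℝ → ℂ} (hf : IsAPFun f) (hc : Continuous g)
    (hg : Integrable g) (x : ℝ) : Integrable fun t => f t * conj (g (t - x)) := by
  obtain ⟨B, hB0, hB⟩ := hf.bounded
  refine ((hg.comp_sub_right x).norm.const_mul B).mono'
    (hf.1.mul (Complex.continuous_conj.comp
      (hc.comp (continuous_id.sub continuous_const)))).aestronglyMeasurable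
    (Eventually.of_forall fun t => ?_)
  rw [norm_mul, RCLike.norm_conj]
  exact mul_le_mul_of_nonneg_right (hB t) (norm_nonneg _)

/-- Shifting the index by `p` amounts to translating `f` by `a p`, at a cost of at most the `L¹`
norm of `g` times the uniform distance between `f` and its translate. It remains to find almost
periods of `f` near the lattice, in fact on it. -/
theorem isAPSeq_integral_mul_conj_translate (ha : 0 < a) {f : ℝ → ℂ} (hf : IsAPFun f)
    (hc : Continuous g) (hg : Integrable g) :
    IsAPSeq fun k : ℤ => ∫ t, f t * conj (g (t - a * k)) := by
  intro ε hε
  set I := ∫ t, ‖g t‖ with hI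
  have hI0 : 0 ≤ I := integral_nonneg fun _ => norm_nonneg _
  obtain ⟨N, hN⟩ := hf.exists_lattice_almost_periods ha (show 0 < ε / (I + 1) by positivity)
  refine ⟨N, fun m => ?_⟩
  obtain ⟨p, hpm, hp⟩ := hN m
  refine ⟨p, hpm, fun n => ?_⟩
  have e : ∫ t, f t * conj (g (t - a * ((n + p : ℤ) : ℝ))) =
      ∫ t, f (t + a * p) * conj (g (t - a * n)) := by
    rw [← integral_add_right_eq_self _ (a * (p : ℝ))]
    congr 1
    funext t
    congr 3
    push_cast; ring
  have hi : Integrable fun t => f (t + a * p) * conj (g (t - a * n)) := by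
    have := (integrable_mul_conj_translate hf hc hg (a * n + a * p)).comp_add_right (a * (p : ℝ))
    refine this.congr (Eventually.of_forall fun t => ?_)
    simp only
    congr 3
    ring
  beta_reduce
  rw [e, ← integral_sub hi (integrable_mul_conj_translate hf hc hg _)]
  calc ‖∫ t, (f (t + a * p) * conj (g (t - a * n)) - f t * conj (g (t - a * n)))‖
      ≤ ∫ t, ε / (I + 1) * ‖g (t - a * n)‖ := by
        refine norm_integral_le_of_norm_le ((hg.comp_sub_right _).norm.const_mul _)
          (Eventually.of_forall fun t => ?_)
        rw [← sub_mul, norm_mul, RCLike.norm_conj]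
        exact mul_le_mul_of_nonneg_right (hp t) (norm_nonneg _)
    _ = ε / (I + 1) * I := by
        rw [integral_const_mul, integral_sub_right_eq_self (fun t => ‖g t‖)]
    _ ≤ ε / (I + 1) * (I + 1) := by gcongr; linarith
    _ = ε := by field_simp

/-- Synthesis with the translates of `g` is adjoint to the pairing with them, up to the factor
given by the density of the lattice. -/
theorem apSeqInner_integral_mul_conj_translate (ha : 0 < a) {f : ℝ → ℂ} (hf : IsAPFun f)
    (hc : Continuous g) (h : HasLatticeMajorant a g v) {b : ℤ → ℂ} (hb : IsAPSeq b) :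
    apSeqInner b (fun k : ℤ => ∫ t, f t * conj (g (t - a * k))) =
      a * apInner (fun t => ∑' k : ℤ, b k * g (t - a * k)) f := by
  obtain ⟨A, hA0, hA⟩ := hf.bounded
  obtain ⟨B, hB0, hB⟩ := hb.bounded
  have hF := isAPFun_tsum_mul_translate ha hc h hb
  have hcoef := isAPSeq_integral_mul_conj_translate ha hf hc (h.integrable hc ha)
  -- The factor `conj f` is moved inside the sum and recentred, so that each summand is a function
  -- of `t - a k`. It depends on `k`, but `B * A` times the majorant of `g` serves all `k`.
  have key := tendsto_average_tsum_lattice (u := fun k s => b k * g s * conj (f (s + a * k))) ha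
    (fun k => (continuous_const.mul hc).mul
      (Complex.continuous_conj.comp (hf.1.comp (by fun_prop))))
    (fun k => h.const_mul (B := B * A) (by positivity) fun x => by
      rw [norm_mul, norm_mul, RCLike.norm_conj, mul_right_comm]
      gcongr
      · exact hB k
      · exact hA _)
  have e1 : ∀ t, ∑' k : ℤ, b k * g (t - a * k) * conj (f (t - a * k + a * k)) =
      (∑' k : ℤ, b k * g (t - a * k)) * conj (f t) := fun t => by
    simp only [sub_add_cancel, tsum_mul_right]
  have e2 : ∀ k : ℤ, ∫ s, b k * g s * conj (f (s + a * k)) =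
      b k * conj (∫ t, f t * conj (g (t - a * k))) := fun k => by
    rw [← integral_conj, ← integral_const_mul,
      ← integral_sub_right_eq_self (fun s => b k * g s * conj (f (s + a * k))) (a * (k : ℝ))]
    congr 1
    funext t
    simp only [map_mul, Complex.conj_conj, sub_add_cancel]
    ring
  simp only [e1, e2] at key
  have h1 := ((hF.tendsto_apInner hf).comp
    (tendsto_natCast_atTop_atTop.const_mul_atTop ha)).const_mul (a : ℂ)
  have h2 := h1.sub key
  rw [sub_zero] at h2
  refine tendsto_nhds_unique (hb.tendsto_apSeqInner hcoef) (h2.congr fun n => ?_)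
  have ha' : (a : ℂ) ≠ 0 := by exact_mod_cast ha.ne'
  simp only [Function.comp, Complex.real_smul]
  push_cast
  -- The window `[-a n, a n]` has length `2 a n`, whereas sequences are normalised by `2 n`; this is
  -- the origin of the factor `a`.
  rw [← mul_assoc, show (a : ℂ) * (2 * ((a : ℂ) * (n : ℂ)))⁻¹ = (2 * (n : ℂ))⁻¹ by
    rw [mul_left_comm 2 (a : ℂ), mul_inv, mul_inv_cancel_left₀ ha']]
  ring

end Layer

/-! ### Trigonometric polynomials -/

theorem integral_exp_period {β : ℝ} (hβ : 0 < β) (n : ℤ) :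
    ∫ s in (0 : ℝ)..(2 * Real.pi / β), Complex.exp (Complex.I * (β * n : ℝ) * s) =
      if n = 0 then ((2 * Real.pi / β : ℝ) : ℂ) else 0 := by
  split_ifs with hn
  · simp [hn]
  · have hβ' : (β : ℂ) ≠ 0 := by exact_mod_cast hβ.ne'
    have hn' : (n : ℂ) ≠ 0 := by exact_mod_cast hn
    rw [integral_exp_mul_complex (by push_cast; simp [hβ', hn', Complex.I_ne_zero])]
    have : Complex.I * ((β * n : ℝ) : ℂ) * ((2 * Real.pi / β : ℝ) : ℂ) =
        n * (2 * Real.pi * Complex.I) := by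
      push_cast; field_simp
    rw [this, Complex.exp_int_mul_two_pi_mul_I]
    simp

/-- The trigonometric polynomial `∑ ℓ ∈ S, c_ℓ exp (i β ℓ s)`. -/
noncomputable def trigPoly (β : ℝ) (S : Finset ℤ) (c : ℤ → ℂ) (s : ℝ) : ℂ :=
  ∑ ℓ ∈ S, c ℓ * Complex.exp (Complex.I * (β * ℓ : ℝ) * s)

section TrigPoly

variable {β : ℝ} {S : Finset ℤ} {c : ℤ → ℂ}

theorem continuous_trigPoly : Continuous (trigPoly β S c) := by
  unfold trigPoly; fun_prop

theorem norm_exp_I_mul (x s : ℝ) : ‖Complex.exp (Complex.I * x * s)‖ = 1 := by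
  rw [show Complex.I * (x : ℂ) * s = ((x * s : ℝ) : ℂ) * Complex.I by push_cast; ring,
    Complex.norm_exp_ofReal_mul_I]

theorem norm_trigPoly_le (s : ℝ) : ‖trigPoly β S c s‖ ≤ ∑ ℓ ∈ S, ‖c ℓ‖ :=
  norm_sum_le_of_le _ fun ℓ _ => by rw [norm_mul, norm_exp_I_mul, mul_one]

theorem periodic_trigPoly (hβ : 0 < β) : Function.Periodic (trigPoly β S c) (2 * Real.pi / β) := by
  intro s
  refine Finset.sum_congr rfl fun ℓ _ => ?_
  have hβ' : (β : ℂ) ≠ 0 := by exact_mod_cast hβ.ne'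
  rw [show Complex.I * ((β * ℓ : ℝ) : ℂ) * ((s + 2 * Real.pi / β : ℝ) : ℂ) =
      Complex.I * ((β * ℓ : ℝ) : ℂ) * s + ℓ * (2 * Real.pi * Complex.I) by
    push_cast; field_simp, Complex.exp_add, Complex.exp_int_mul_two_pi_mul_I, mul_one]

theorem integral_norm_sq_trigPoly (hβ : 0 < β) :
    ∫ s in (0 : ℝ)..(2 * Real.pi / β), ‖trigPoly β S c s‖ ^ 2 =
      2 * Real.pi / β * ∑ ℓ ∈ S, ‖c ℓ‖ ^ 2 := by
  have e : ∀ s : ℝ, ((‖trigPoly β S c s‖ ^ 2 : ℝ) : ℂ) = ∑ ℓ ∈ S, ∑ m ∈ S,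
      c ℓ * conj (c m) * Complex.exp (Complex.I * (β * (ℓ - m : ℤ) : ℝ) * s) := fun s => by
    rw [← Complex.normSq_eq_norm_sq, ← Complex.mul_conj, trigPoly, map_sum, Finset.sum_mul_sum]
    refine Finset.sum_congr rfl fun ℓ _ => Finset.sum_congr rfl fun m _ => ?_
    rw [map_mul, ← Complex.exp_conj, mul_mul_mul_comm, ← Complex.exp_add]
    congr 2
    simp only [map_mul, Complex.conj_I, Complex.conj_ofReal]
    push_cast; ring
  rw [← Complex.ofReal_inj, ← intervalIntegral.integral_ofReal]
  simp only [e]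
  have hint : ∀ ℓ m : ℤ, IntervalIntegrable (fun s : ℝ =>
      c ℓ * conj (c m) * Complex.exp (Complex.I * (β * (ℓ - m : ℤ) : ℝ) * s)) volume 0
      (2 * Real.pi / β) := fun ℓ m => Continuous.intervalIntegrable (by fun_prop) _ _
  rw [intervalIntegral.integral_finsetSum fun ℓ _ =>
    Continuous.intervalIntegrable (by fun_prop) _ _]
  rw [Complex.ofReal_mul, Complex.ofReal_sum, Finset.mul_sum]
  refine Finset.sum_congr rfl fun ℓ hℓ => ?_
  rw [intervalIntegral.integral_finsetSum fun m _ => hint ℓ m]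
  simp only [intervalIntegral.integral_const_mul, integral_exp_period hβ, sub_eq_zero, mul_ite,
    mul_zero]
  rw [Finset.sum_ite_eq, if_pos hℓ, Complex.mul_conj, Complex.normSq_eq_norm_sq]
  push_cast; ring

/-- A trigonometric polynomial is square integrable for a weight with a lattice majorant. -/
theorem integral_norm_sq_trigPoly_mul_le (hβ : 0 < β) {ψ : ℝ → ℂ} (hc : Continuous ψ) {w : ℤ → ℝ}
    (hw : HasLatticeMajorant (2 * Real.pi / β) ψ w) :
    ∫ s, ‖trigPoly β S c s‖ ^ 2 * ‖ψ s‖ ≤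
      (∑' j, w j) * (2 * Real.pi / β * ∑ ℓ ∈ S, ‖c ℓ‖ ^ 2) := by
  have hp : 0 < 2 * Real.pi / β := by positivity
  have hQ : Continuous fun s => ‖trigPoly β S c s‖ ^ 2 := continuous_trigPoly.norm.pow 2
  have hcont : Continuous fun s => ‖trigPoly β S c s‖ ^ 2 * ‖ψ s‖ := hQ.mul hc.norm
  -- This crude bound serves only for integrability; its constant does not enter the estimate.
  have hmaj : HasLatticeMajorant (2 * Real.pi / β) (fun s => ‖trigPoly β S c s‖ ^ 2 * ‖ψ s‖) _ :=
    hw.const_mul (B := (∑ ℓ ∈ S, ‖c ℓ‖) ^ 2) (by positivity) fun s => by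
      rw [Real.norm_of_nonneg (by positivity)]
      gcongr
      exact norm_trigPoly_le s
  have hsum := hasSum_integral_cells hp (hmaj.integrable hcont hp)
  refine hasSum_le (fun j => ?_) hsum (hw.1.hasSum.mul_right _)
  have hle : 2 * Real.pi / β * j ≤ 2 * Real.pi / β * (j + 1) := by nlinarith
  calc ∫ s in (2 * Real.pi / β * j)..(2 * Real.pi / β * (j + 1)), ‖trigPoly β S c s‖ ^ 2 * ‖ψ s‖
      ≤ ∫ s in (2 * Real.pi / β * j)..(2 * Real.pi / β * (j + 1)),
          w j * ‖trigPoly β S c s‖ ^ 2 := by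
        refine intervalIntegral.integral_mono_on hle (hcont.intervalIntegrable _ _)
          ((continuous_const.mul hQ).intervalIntegrable _ _) fun s hs => ?_
        rw [mul_comm]
        gcongr
        exact hw.2 j s hs
    _ = w j * (2 * Real.pi / β * ∑ ℓ ∈ S, ‖c ℓ‖ ^ 2) := by
        -- The cells have exactly the length of a period, so Parseval gives the same value on each
        -- of them.
        have hper : Function.Periodic (fun s => ‖trigPoly β S c s‖ ^ 2) (2 * Real.pi / β) :=
          (periodic_trigPoly hβ).comp fun z => ‖z‖ ^ 2
        rw [intervalIntegral.integral_const_mul, mul_add, mul_one,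
          hper.intervalIntegral_add_eq _ 0, zero_add, integral_norm_sq_trigPoly hβ]

end TrigPoly

/-- Cauchy–Schwarz after splitting `|x| |y|` as `|x| |y|^(1/2)` times `|y|^(1/2)`, on finite sums
and then in the limit. -/
theorem norm_tsum_mul_sq_le {ι : Type*} {x y : ι → ℂ} {V : ℝ}
    (hy : Summable fun i => ‖y i‖) (hV : ∑' i, ‖y i‖ ≤ V)
    (hxy : Summable fun i => x i * y i) (hx : Summable fun i => ‖x i‖ ^ 2 * ‖y i‖) :
    ‖∑' i, x i * y i‖ ^ 2 ≤ V * ∑' i, ‖x i‖ ^ 2 * ‖y i‖ := by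
  refine le_of_tendsto (hxy.hasSum.norm.pow 2) (Eventually.of_forall fun s => ?_)
  calc ‖∑ i ∈ s, x i * y i‖ ^ 2 ≤ (∑ i ∈ s, ‖x i‖ * ‖y i‖) ^ 2 := by
        gcongr
        exact norm_sum_le_of_le _ fun i _ => (norm_mul _ _).le
    _ ≤ (∑ i ∈ s, ‖y i‖) * ∑ i ∈ s, ‖x i‖ ^ 2 * ‖y i‖ :=
        Finset.sum_sq_le_sum_mul_sum_of_sq_le_mul _ (fun _ _ => norm_nonneg _)
          (fun _ _ => by positivity) fun i _ => le_of_eq (by ring)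
    _ ≤ V * ∑' i, ‖x i‖ ^ 2 * ‖y i‖ := by
        have h1 := hy.sum_le_tsum s fun _ _ => norm_nonneg _
        have h2 := hx.sum_le_tsum s fun i _ => by positivity
        have h3 : 0 ≤ V := (tsum_nonneg fun _ => norm_nonneg _).trans hV
        exact mul_le_mul (h1.trans hV) h2 (Finset.sum_nonneg fun i _ => by positivity) h3


/-! ### The synthesis and analysis bounds -/

theorem APFun.sum_apply {ι : Type*} (S : Finset ι) (f : ι → APFun) (t : ℝ) :
    (∑ i ∈ S, f i : APFun) t = ∑ i ∈ S, f i t := by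
  classical
  induction S using Finset.induction_on with
  | empty => rfl
  | insert i S hi ih => rw [Finset.sum_insert hi, Finset.sum_insert hi, ← ih]; rfl

section Gabor

variable {α β : ℝ} {ψ : ℝ → ℂ} {v w : ℤ → ℝ}

theorem norm_modulation (ω : ℝ) (x : ℝ) : ‖modulation ω ψ x‖ = ‖ψ x‖ := by
  rw [modulation, norm_mul, norm_exp_I_mul, one_mul]

theorem continuous_modulation (hc : Continuous ψ) (ω : ℝ) : Continuous (modulation ω ψ) := by
  unfold modulation; fun_prop

theorem HasLatticeMajorant.modulation (h : HasLatticeMajorant α ψ v) (ω : ℝ) :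
    HasLatticeMajorant α (modulation ω ψ) v :=
  h.mono fun x => (norm_modulation ω x).le

theorem isAPFun_synthesisLayer (hα : 0 < α) (hc : Continuous ψ) (h : HasLatticeMajorant α ψ v)
    (b : APSeq) (ℓ : ℤ) : IsAPFun (synthesisLayer α β ψ b ℓ) :=
  isAPFun_tsum_mul_translate hα (continuous_modulation hc _) (h.modulation _) b.isAPSeq

/-- The `ℓ`-th layer of the synthesis map as a linear map. -/
noncomputable def layerMap (β : ℝ) (hα : 0 < α) (hc : Continuous ψ)
    (h : HasLatticeMajorant α ψ v) (ℓ : ℤ) : APSeq →ₗ[ℂ] APFun where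
  toFun b := APFun.mk (synthesisLayer α β ψ b ℓ) (isAPFun_synthesisLayer hα hc h b ℓ)
  map_add' b c := Subtype.ext <| funext fun t => by
    have h1 := summable_mul_translate hα (h.modulation (β * ℓ)) b.isAPSeq t
    have h2 := summable_mul_translate hα (h.modulation (β * ℓ)) c.isAPSeq t
    refine Eq.trans (tsum_congr fun k => ?_) (h1.tsum_add h2)
    exact add_mul _ _ _
  map_smul' z b := Subtype.ext <| funext fun t => by
    refine Eq.trans (tsum_congr fun k => ?_) (tsum_mul_left (a := z))
    exact mul_assoc _ _ _

/-- The phase of a translated modulation depends on `t - α k` alone, so at each `k` the layers add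
up to one trigonometric polynomial times `ψ`, both evaluated at `t - α k`. -/
theorem sum_layerMap_apply (hα : 0 < α) (hc : Continuous ψ) (h : HasLatticeMajorant α ψ v)
    (S : Finset ℤ) (c : ℤ → APSeq) (t : ℝ) :
    (∑ ℓ ∈ S, layerMap β hα hc h ℓ (c ℓ) : APFun) t =
      ∑' k : ℤ, trigPoly β S (fun ℓ => c ℓ k) (t - α * k) * ψ (t - α * k) := by
  have hs : ∀ ℓ ∈ S, Summable fun k : ℤ => c ℓ k * modulation (β * ℓ) ψ (t - α * k) := fun ℓ _ =>
    summable_mul_translate hα (h.modulation (β * ℓ)) (c ℓ).isAPSeq t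
  rw [APFun.sum_apply]
  refine (Summable.tsum_finsetSum hs).symm.trans (tsum_congr fun k => ?_)
  rw [trigPoly, Finset.sum_mul]
  refine Finset.sum_congr rfl fun ℓ _ => ?_
  rw [modulation]
  push_cast
  ring

/-- The constant is the product of the lattice density `α⁻¹`, the factor `∑ j, v j` from the
weighted Cauchy–Schwarz inequality, and the factor from Parseval on the cells of length `2π/β`. No
cardinality of `S` enters, which makes the passage to infinitely many layers possible. -/
theorem norm_sum_layerMap_sq_le (hα : 0 < α) (hβ : 0 < β) (hc : Continuous ψ)
    (h : HasLatticeMajorant α ψ v) (hw : HasLatticeMajorant (2 * Real.pi / β) ψ w)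
    (S : Finset ℤ) (c : ℤ → APSeq) :
    ‖∑ ℓ ∈ S, layerMap β hα hc h ℓ (c ℓ)‖ ^ 2 ≤
      α⁻¹ * (∑' j, v j) * ((∑' j, w j) * (2 * Real.pi / β)) * ∑ ℓ ∈ S, ‖c ℓ‖ ^ 2 := by
  set F := ∑ ℓ ∈ S, layerMap β hα hc h ℓ (c ℓ) with hF
  set V := ∑' j, v j with hV
  set K := (∑' j, w j) * (2 * Real.pi / β) with hK
  choose B hB0 hB using fun ℓ => (c ℓ).isAPSeq.bounded
  set A := ∑ ℓ ∈ S, B ℓ with hA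
  have hV0 : 0 ≤ V := tsum_nonneg fun j => h.nonneg hα j
  set Q : ℤ → ℝ → ℂ := fun k => trigPoly β S (fun ℓ => c ℓ k) with hQ
  have hQA : ∀ k s, ‖Q k s‖ ≤ A := fun k s =>
    (norm_trigPoly_le s).trans (Finset.sum_le_sum fun ℓ _ => hB ℓ k)
  have hQc : ∀ k, Continuous (Q k) := fun k => continuous_trigPoly
  set u : ℤ → ℝ → ℝ := fun k s => ‖Q k s‖ ^ 2 * ‖ψ s‖ with hu
  have huc : ∀ k, Continuous (u k) := fun k => ((hQc k).norm.pow 2).mul hc.norm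
  -- The bound `A` depends on `S` and `c`. It only has to be uniform in `k`, to make the averaging
  -- lemma applicable.
  have hum : ∀ k, HasLatticeMajorant α (u k) (fun j => A ^ 2 * v j) := fun k =>
    h.const_mul (by positivity) fun s => by
      rw [Real.norm_of_nonneg (by positivity)]
      exact mul_le_mul_of_nonneg_right (pow_le_pow_left₀ (norm_nonneg _) (hQA k s) 2)
        (norm_nonneg _)
  have hpt : ∀ t, ‖F t‖ ^ 2 ≤ V * ∑' k : ℤ, u k (t - α * k) := fun t => by
    rw [hF, sum_layerMap_apply hα hc h]
    refine norm_tsum_mul_sq_le (h.summable_norm hα t) (h.tsum_norm_le hα t) ?_ ?_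
    · refine Summable.of_norm_bounded ((h.summable_norm hα t).mul_left A) fun k => ?_
      rw [norm_mul]
      exact mul_le_mul_of_nonneg_right (hQA k _) (norm_nonneg _)
    · exact (summable_norm_lattice hα hum t).of_norm
  have huint : ∀ k, ∫ s, u k s ≤ K * ∑ ℓ ∈ S, ‖c ℓ k‖ ^ 2 := fun k => by
    rw [hK, mul_assoc]
    exact integral_norm_sq_trigPoly_mul_le hβ hc hw
  have hHc := continuous_tsum_lattice hα huc hum
  have lim1 := F.isAPFun.tendsto_apInner_self.comp
    (tendsto_natCast_atTop_atTop.const_mul_atTop hα)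
  -- The first summand is the vanishing discrepancy between the window integral and the sum of the
  -- `∫ u k`; the second dominates the average of those integrals. The inequality is compared along
  -- `T = α n` and then passed to the limit.
  have lim2 := (tendsto_average_tsum_lattice hα huc hum).add
    ((tendsto_finsetSum S fun ℓ _ => (c ℓ).isAPSeq.tendsto_apSeqInner_self).const_mul K)
  have lim3 := lim2.const_mul (α⁻¹ * V)
  rw [APFun.norm_sq, mul_assoc _ K]
  simp only [APSeq.norm_sq]
  rw [zero_add] at lim3
  refine le_of_tendsto_of_tendsto' lim1 lim3 fun n => ?_
  have e1 : ∫ t in (-(α * n))..(α * n), ‖F t‖ ^ 2 ≤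
      V * ∫ t in (-(α * n))..(α * n), ∑' k : ℤ, u k (t - α * k) := by
    rw [← intervalIntegral.integral_const_mul]
    have hn : (0 : ℝ) ≤ α * n := by positivity
    exact intervalIntegral.integral_mono_on (by linarith)
      ((F.isAPFun.1.norm.pow 2).intervalIntegrable _ _)
      ((continuous_const.mul hHc).intervalIntegrable _ _) fun t _ => hpt t
  have e2 : ∑ k ∈ Finset.Icc (-(n : ℤ)) n, ∫ s, u k s ≤
      K * ∑ ℓ ∈ S, ∑ k ∈ Finset.Icc (-(n : ℤ)) n, ‖c ℓ k‖ ^ 2 := by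
    rw [Finset.sum_comm, Finset.mul_sum]
    exact Finset.sum_le_sum fun k _ => huint k
  simp only [Function.comp, smul_eq_mul]
  rw [← Finset.mul_sum, mul_left_comm K, ← mul_add, ← mul_assoc 2 α, mul_comm 2 α, mul_assoc α 2,
    mul_inv α, mul_assoc, mul_assoc, mul_left_comm V]
  gcongr
  exact e1.trans (mul_le_mul_of_nonneg_left (by linarith) hV0)

/-! ### From finite sums of layers to the synthesis operator. -/

theorem EllTwoAPSeq.hasSum_norm_sq (a : EllTwoAPSeq) :
    HasSum (fun ℓ => ‖a ℓ‖ ^ 2) (‖a‖ ^ 2) := by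
  have := lp.hasSum_norm (p := 2) (by simp) a
  simpa using this

/-- Layers with a uniform `ℓ²` bound on finite sums define a continuous synthesis map. -/
theorem exists_synthesis {D : ℤ → APSeq →ₗ[ℂ] APFun} {C : ℝ} (hC : 0 ≤ C)
    (hD : ∀ (S : Finset ℤ) (c : ℤ → APSeq), ‖∑ ℓ ∈ S, D ℓ (c ℓ)‖ ^ 2 ≤ C * ∑ ℓ ∈ S, ‖c ℓ‖ ^ 2) :
    ∃ T : EllTwoAPSeq →L[ℂ] APTwo, ∀ a : EllTwoAPSeq,
      HasSum (fun ℓ : ℤ => (D ℓ (a ℓ) : APTwo)) (T a) := by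
  have hn : ∀ (S : Finset ℤ) (c : ℤ → APSeq),
      ‖∑ ℓ ∈ S, (D ℓ (c ℓ) : APTwo)‖ ^ 2 ≤ C * ∑ ℓ ∈ S, ‖c ℓ‖ ^ 2 := fun S c => by
    have : ∑ ℓ ∈ S, (D ℓ (c ℓ) : APTwo) = ((∑ ℓ ∈ S, D ℓ (c ℓ) : APFun) : APTwo) :=
      (map_sum (UniformSpace.Completion.toComplₗᵢ (𝕜 := ℂ) (E := APFun)) _ _).symm
    rw [this, UniformSpace.Completion.norm_coe]
    exact hD S c
  -- The Cauchy criterion over finite sets of indices yields unconditional convergence. Writing `C +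
  -- 1` avoids division by zero.
  have hs : ∀ a : EllTwoAPSeq, Summable fun ℓ : ℤ => (D ℓ (a ℓ) : APTwo) := fun a => by
    rw [summable_iff_vanishing_norm]
    intro ε hε
    obtain ⟨s, hs⟩ := summable_iff_vanishing_norm.1 (EllTwoAPSeq.hasSum_norm_sq a).summable
      (ε ^ 2 / (C + 1)) (by positivity)
    refine ⟨s, fun t ht => ?_⟩
    have h1 := (le_abs_self _).trans_lt (hs t ht)
    have h0 : 0 ≤ ∑ ℓ ∈ t, ‖a ℓ‖ ^ 2 := Finset.sum_nonneg fun _ _ => by positivity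
    refine lt_of_pow_lt_pow_left₀ 2 hε.le ((hn t a).trans_lt ?_)
    rw [lt_div_iff₀ (by positivity)] at h1
    nlinarith
  refine ⟨LinearMap.mkContinuous
    { toFun := fun a => ∑' ℓ : ℤ, (D ℓ (a ℓ) : APTwo)
      map_add' := fun a b => ?_
      map_smul' := fun z a => ?_ } (Real.sqrt C) fun a => ?_, fun a => (hs a).hasSum⟩
  · rw [← (hs a).tsum_add (hs b)]
    refine tsum_congr fun ℓ => ?_
    rw [lp.coeFn_add, Pi.add_apply, map_add, UniformSpace.Completion.coe_add]
  · rw [RingHom.id_apply, ← (hs a).tsum_const_smul]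
    refine tsum_congr fun ℓ => ?_
    rw [lp.coeFn_smul, Pi.smul_apply, map_smul, UniformSpace.Completion.coe_smul]
  · rw [← Real.sqrt_sq (norm_nonneg a), ← Real.sqrt_mul hC]
    refine Real.le_sqrt_of_sq_le (le_of_tendsto ((hs a).hasSum.norm.pow 2)
      (Eventually.of_forall fun S => (hn S a).trans ?_))
    gcongr
    exact sum_le_hasSum S (fun _ _ => by positivity) (EllTwoAPSeq.hasSum_norm_sq a)

/-! ### The analysis bound by duality. -/

/-- The sequence of pairings of `f` with the translates of a modulation of `ψ`. -/
noncomputable def analysisCoeff (β : ℝ) (hα : 0 < α) (hc : Continuous ψ)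
    (h : HasLatticeMajorant α ψ v) (f : APFun) (ℓ : ℤ) : APSeq :=
  ⟨fun k => dualPairing f (translation (α * k) (modulation (β * ℓ) ψ)),
    isAPSeq_integral_mul_conj_translate hα f.isAPFun (continuous_modulation hc _)
      ((h.modulation _).integrable (continuous_modulation hc _) hα)⟩

/-- The adjointness relation in terms of `inner`, which is conjugate-linear in its first argument
and so takes the arguments of `apSeqInner` and `apInner` in reverse order. -/
theorem inner_analysisCoeff (hα : 0 < α) (hc : Continuous ψ) (h : HasLatticeMajorant α ψ v)
    (f : APFun) (ℓ : ℤ) (b : APSeq) :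
    inner ℂ (analysisCoeff β hα hc h f ℓ) b = α * inner ℂ f (layerMap β hα hc h ℓ b) :=
  apSeqInner_integral_mul_conj_translate hα f.isAPFun (continuous_modulation hc _)
    (h.modulation _) b.isAPSeq

/-- Synthesising `F` from the coefficients of `f` on `S` gives `X = α ⟨f, F⟩` for their square sum
`X`. Since `‖F‖² ≤ C X`, Cauchy–Schwarz yields `X² ≤ α² C ‖f‖² X`, and one factor `X` cancels. -/
theorem sum_norm_sq_analysisCoeff_le (hα : 0 < α) (hc : Continuous ψ)
    (h : HasLatticeMajorant α ψ v) {C : ℝ} (hC : 0 ≤ C) (hD : ∀ (S : Finset ℤ) (c : ℤ → APSeq),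
      ‖∑ ℓ ∈ S, layerMap β hα hc h ℓ (c ℓ)‖ ^ 2 ≤ C * ∑ ℓ ∈ S, ‖c ℓ‖ ^ 2)
    (f : APFun) (S : Finset ℤ) :
    ∑ ℓ ∈ S, ‖analysisCoeff β hα hc h f ℓ‖ ^ 2 ≤ α ^ 2 * C * ‖f‖ ^ 2 := by
  set c := analysisCoeff β hα hc h f with hcdef
  set X := ∑ ℓ ∈ S, ‖c ℓ‖ ^ 2 with hX
  set F := ∑ ℓ ∈ S, layerMap β hα hc h ℓ (c ℓ) with hF
  have e : (X : ℂ) = α * inner ℂ f F := by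
    rw [hF, inner_sum, Finset.mul_sum, hX]
    push_cast
    refine Finset.sum_congr rfl fun ℓ _ => ?_
    rw [← inner_analysisCoeff]
    exact (inner_self_eq_norm_sq_to_K (𝕜 := ℂ) (c ℓ)).symm
  have hX0 : 0 ≤ X := Finset.sum_nonneg fun _ _ => by positivity
  have h1 : X ≤ α * (‖f‖ * ‖F‖) := by
    have := congrArg norm e
    rw [norm_mul, Complex.norm_real, Complex.norm_real, Real.norm_of_nonneg hX0,
      Real.norm_of_nonneg hα.le] at this
    rw [this]
    gcongr
    exact norm_inner_le_norm f F
  have h2 : X ^ 2 ≤ α ^ 2 * C * ‖f‖ ^ 2 * X := by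
    calc X ^ 2 ≤ (α * (‖f‖ * ‖F‖)) ^ 2 := by gcongr
      _ = α ^ 2 * ‖f‖ ^ 2 * ‖F‖ ^ 2 := by ring
      _ ≤ α ^ 2 * ‖f‖ ^ 2 * (C * X) := by gcongr; exact hD S c
      _ = _ := by ring
  rcases hX0.eq_or_lt with h0 | h0
  · rw [← h0]; positivity
  · rw [sq] at h2
    exact le_of_mul_le_mul_right h2 h0

/-- Two lattices are needed at once: step `α` for the translations and step `2π/β`, the common
period of the modulations. Both majorants come from the one for unit cells. -/
theorem MemWienerCont.exists_layer_bound (hα : 0 < α) (hβ : 0 < β) (hψ : MemWienerCont ψ) :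
    ∃ (v : ℤ → ℝ) (h : HasLatticeMajorant α ψ v) (C : ℝ), 0 ≤ C ∧
      ∀ (S : Finset ℤ) (c : ℤ → APSeq),
        ‖∑ ℓ ∈ S, layerMap β hα hψ.1 h ℓ (c ℓ)‖ ^ 2 ≤ C * ∑ ℓ ∈ S, ‖c ℓ‖ ^ 2 := by
  obtain ⟨w₁, hw₁⟩ := hψ.exists_hasLatticeMajorant
  obtain ⟨v, hv⟩ := hw₁.change_lattice hψ.1 one_pos hα
  have hp : 0 < 2 * Real.pi / β := by positivity
  obtain ⟨w, hw⟩ := hw₁.change_lattice hψ.1 one_pos hp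
  have hv0 : 0 ≤ ∑' j, v j := tsum_nonneg fun j => hv.nonneg hα j
  have hw0 : 0 ≤ ∑' j, w j := tsum_nonneg fun j => hw.nonneg hp j
  exact ⟨v, hv, _, by positivity, norm_sum_layerMap_sq_le hα hβ hψ.1 hv hw⟩

end Gabor

theorem mainTheorem5 (α β : ℝ) (hα : 0 < α) (hβ : 0 < β) (ψ : ℝ → ℂ) (hψ : MemWienerCont ψ) :
    (∀ (b : APSeq) (ℓ : ℤ) (t : ℝ),
      Summable fun k : ℤ => b k * translation (α * k) (modulation (β * ℓ) ψ) t) ∧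
    (∃ hAP : ∀ (b : APSeq) (ℓ : ℤ), IsAPFun (synthesisLayer α β ψ b ℓ),
      ∃ T : EllTwoAPSeq →L[ℂ] APTwo, ∀ a : EllTwoAPSeq,
        HasSum (fun ℓ : ℤ => (APFun.mk (synthesisLayer α β ψ (a ℓ) ℓ) (hAP (a ℓ) ℓ) : APTwo))
          (T a)) ∧
    (∃ C : ℝ, ∀ f : APFun,
      (∀ k ℓ : ℤ, Integrable fun t : ℝ =>
        f t * conj (translation (α * k) (modulation (β * ℓ) ψ) t)) ∧
      ∃ c : ℤ → APSeq,
        (∀ ℓ k : ℤ, c ℓ k = dualPairing f (translation (α * k) (modulation (β * ℓ) ψ))) ∧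
        Summable (fun ℓ : ℤ => ‖c ℓ‖ ^ 2) ∧ ∑' ℓ : ℤ, ‖c ℓ‖ ^ 2 ≤ C * ‖f‖ ^ 2) := by
  have hc := hψ.1
  obtain ⟨v, hv, C, hC0, hD⟩ := hψ.exists_layer_bound hα hβ
  have hA := sum_norm_sq_analysisCoeff_le hα hc hv hC0 hD
  have h1 : ∀ (b : APSeq) (ℓ : ℤ) (t : ℝ),
      Summable fun k : ℤ => b k * translation (α * k) (modulation (β * ℓ) ψ) t :=
    fun b ℓ t => summable_mul_translate hα (hv.modulation (β * ℓ)) b.isAPSeq t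
  have h2 := exists_synthesis hC0 hD
  have h3 : ∀ (f : APFun) (k ℓ : ℤ), Integrable fun t : ℝ =>
        f t * conj (translation (α * k) (modulation (β * ℓ) ψ) t) := fun f k ℓ =>
    integrable_mul_conj_translate f.isAPFun (continuous_modulation hc _)
      ((hv.modulation _).integrable (continuous_modulation hc _) hα) _
  -- Each value of `layerMap` is by definition the `APFun.mk` of the statement, so `h2` applies as
  -- it stands.
  refine ⟨h1, ⟨isAPFun_synthesisLayer hα hc hv, h2⟩, α ^ 2 * C, fun f => ⟨h3 f,
    analysisCoeff β hα hc hv f, fun ℓ k => rfl, ?_, ?_⟩⟩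
  · exact summable_of_sum_le (fun ℓ => sq_nonneg _) (hA f)
  · exact Real.tsum_le_of_sum_le (fun ℓ => sq_nonneg _) (hA f)
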